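/- Let $(M^n,g)$ be a closed (compact, without boundary) smooth Riemannian manifold with Riemannian volume measure $d\nu$, let $f:M\to\mathbb R$ be a $C^2$ function, $d\mu=e^{-f}d\nu$, and let $T$ be a smooth $(1,1)$-tensor field on $M$ that is symmetric and positive definite with respect to $g=\langle\cdot,\cdot\rangle$. Write $T(X,Y)=\langle T(X),Y\rangle$ and $$\mathcal L u=\operatorname{div}_f(T(\nabla u))=\operatorname{div}(T(\nabla u))-\langle\nabla f,T(\nabla u)\rangle .$$ Let $a<b$, let $\phi:[a,b]\to\mathbb R$ be smooth, and let $u=(u^1,\dots,u^m):M\times[a,b]\to\mathbb R^m$ be smooth, not identically zero, and a solution of $$u_t(x,t)-\mathcal Lu(x,t)=\phi(t)\,u(x,t)\qquad (x\in M,\ t\in[a,b]),$$ where $\mathcal L$ acts on each component. Put $$I(t)=\int_M|u|^2\,d\mu,\qquad D(t)=-\int_M\sum_{j=1}^mT(\nabla u^j,\nabla u^j)\,d\mu,\qquad U(t)=\frac{D(t)}{I(t)} .$$ Then $I(t)>0$ for every $t\in[a,b]$ (so that $U$ is well defined on $[a,b]$), and $U$ is nondecreasing on $[a,b]$. Moreover,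 if $U$ is constant on $[a,b]$, then for every $t\in[a,b]$ the function $u(\cdot,t)$ is an eigenfunction of $\mathcal L$, namely $u(\cdot,t)\not\equiv0$ and $\mathcal Lu(\cdot,t)=U(t)\,u(\cdot,t)$, and $$u(x,t)=e^{\,tU(t)-aU(a)+\int_a^t\phi(\tau)\,d\tau}\,u(x,a)\qquad (x\in M).$$ Also, if $\phi$ is nondecreasing on $[a,b]$, then $\log I$ is convex on $[a,b]$. -/

import Mathlib

open scoped Manifold ContDiff
open Bundle MeasureTheory

noncomputable section

namespace WeightedManifold

/-- A smooth Riemannian metric on the tangent bundle of an `n`-dimensional manifold `M`. -/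
abbrev Metric (n : ℕ) (M : Type*) [TopologicalSpace M]
    [ChartedSpace (EuclideanSpace ℝ (Fin n)) M] [IsManifold (𝓡 n) ∞ M] : Type _ :=
  ContMDiffRiemannianMetric (𝓡 n) ∞ (EuclideanSpace ℝ (Fin n))
    (fun x : M => TangentSpace (𝓡 n) x)

section Geometry

variable {n : ℕ} {M : Type*} [TopologicalSpace M]
  [ChartedSpace (EuclideanSpace ℝ (Fin n)) M] [IsManifold (𝓡 n) ∞ M]

/-- The metric at `x` as a bilinear form on the tangent space. -/
def bilin (g : Metric n M) (x : M) : LinearMap.BilinForm ℝ (TangentSpace (𝓡 n) x) :=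
  LinearMap.mk₂ ℝ (fun v w => g.inner x v w)
    (fun v v' w => by simp) (fun c v w => by simp)
    (fun v w w' => by simp) (fun c v w => by simp)

theorem bilin_nondegenerate (g : Metric n M) (x : M) : (bilin g x).Nondegenerate := by
  have key : ∀ v : TangentSpace (𝓡 n) x, g.inner x v v = 0 → v = 0 := by
    intro v hv
    by_contra h
    exact (g.pos x v h).ne' hv
  exact ⟨fun v hv => key v (hv v), fun v hv => key v (hv v)⟩

instance (x : M) : FiniteDimensional ℝ (TangentSpace (𝓡 n) x) :=
  inferInstanceAs (FiniteDimensional ℝ (EuclideanSpace ℝ (Fin n)))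

/-- The gradient of a real function: the vector field with `⟨∇u, v⟩ = du(v)`. -/
def grad (g : Metric n M) (u : M → ℝ) (x : M) : TangentSpace (𝓡 n) x :=
  ((bilin g x).toDual (bilin_nondegenerate g x)).symm
    ((mfderiv (𝓡 n) 𝓘(ℝ, ℝ) u x).toLinearMap)

/-- The coordinate vector field `∂ᵢ` of the chart at `c`, at the point with coordinates `y`. -/
def coordVec (c : M) (y : EuclideanSpace ℝ (Fin n)) (i : Fin n) :
    TangentSpace (𝓡 n) ((extChartAt (𝓡 n) c).symm y) :=
  mfderiv 𝓘(ℝ, EuclideanSpace ℝ (Fin n)) (𝓡 n) (extChartAt (𝓡 n) c).symm y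
    (EuclideanSpace.single i (1 : ℝ))

/-- The matrix `gᵢⱼ = ⟨∂ᵢ, ∂ⱼ⟩` of the metric in the chart at `c`. -/
def gram (g : Metric n M) (c : M) (y : EuclideanSpace ℝ (Fin n)) : Matrix (Fin n) (Fin n) ℝ :=
  Matrix.of fun i j => g.inner ((extChartAt (𝓡 n) c).symm y) (coordVec c y i) (coordVec c y j)

/-- The Riemannian volume density `√det(gᵢⱼ)` in the chart at `c`. -/
def density (g : Metric n M) (c : M) (y : EuclideanSpace ℝ (Fin n)) : ℝ :=
  Real.sqrt (gram g c y).det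

/-- The `i`-th component of the vector field `X` in the chart at `c`,
as a function of the coordinates `y`. -/
def component (X : ∀ x : M, TangentSpace (𝓡 n) x) (c : M) (i : Fin n)
    (y : EuclideanSpace ℝ (Fin n)) : ℝ :=
  (show EuclideanSpace ℝ (Fin n) from
    mfderiv (𝓡 n) 𝓘(ℝ, EuclideanSpace ℝ (Fin n)) (extChartAt (𝓡 n) c)
      ((extChartAt (𝓡 n) c).symm y) (X ((extChartAt (𝓡 n) c).symm y))) i

/-- The Riemannian divergence `div X = (1 / √det g) ∑ᵢ ∂ᵢ (√det g Xⁱ)`,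
computed at `x` in the chart at `x`. -/
def divergence (g : Metric n M) (X : ∀ x : M, TangentSpace (𝓡 n) x) (x : M) : ℝ :=
  (density g x (extChartAt (𝓡 n) x x))⁻¹ *
    ∑ i : Fin n,
      fderiv ℝ (fun y => density g x y * component X x i y) (extChartAt (𝓡 n) x x)
        (EuclideanSpace.single i (1 : ℝ))

/-- The operator `𝓛 u = div (T ∇u) - ⟨∇f, T ∇u⟩` on real functions. -/
def diffusion (g : Metric n M) (f : M → ℝ)
    (T : ∀ x : M, TangentSpace (𝓡 n) x →L[ℝ] TangentSpace (𝓡 n) x) (u : M → ℝ) (x : M) : ℝ :=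
  divergence g (fun y => T y (grad g u y)) x - g.inner x (grad g f x) (T x (grad g u x))

/-- The operator `𝓛` on `ℝᵐ`-valued functions, acting on each component. -/
def diffusionVec {m : ℕ} (g : Metric n M) (f : M → ℝ)
    (T : ∀ x : M, TangentSpace (𝓡 n) x →L[ℝ] TangentSpace (𝓡 n) x)
    (v : M → EuclideanSpace ℝ (Fin m)) (x : M) : EuclideanSpace ℝ (Fin m) :=
  WithLp.toLp 2 fun j => diffusion g f T (fun y => v y j) x

/-- `v` is an eigenfunction of `𝓛` with `𝓛 v = c v`. -/
def IsEigenfunction {m : ℕ} (g : Metric n M) (f : M → ℝ)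
    (T : ∀ x : M, TangentSpace (𝓡 n) x →L[ℝ] TangentSpace (𝓡 n) x) (c : ℝ)
    (v : M → EuclideanSpace ℝ (Fin m)) : Prop :=
  v ≠ 0 ∧ ∀ x, diffusionVec g f T v x = c • v x

/-- `T` is a smooth `(1,1)`-tensor field, symmetric and positive definite for `g`. -/
structure IsSymmPosDefTensor (g : Metric n M)
    (T : ∀ x : M, TangentSpace (𝓡 n) x →L[ℝ] TangentSpace (𝓡 n) x) : Prop where
  smooth : ContMDiff (𝓡 n)
    ((𝓡 n).prod 𝓘(ℝ, EuclideanSpace ℝ (Fin n) →L[ℝ] EuclideanSpace ℝ (Fin n))) ∞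
    (fun x : M => TotalSpace.mk' (EuclideanSpace ℝ (Fin n) →L[ℝ] EuclideanSpace ℝ (Fin n))
      (E := fun x : M => TangentSpace (𝓡 n) x →L[ℝ] TangentSpace (𝓡 n) x) x (T x))
  symm : ∀ (x : M) (v w : TangentSpace (𝓡 n) x), g.inner x (T x v) w = g.inner x v (T x w)
  pos : ∀ (x : M) (v : TangentSpace (𝓡 n) x), v ≠ 0 → 0 < g.inner x (T x v) v

section Measure

/-- A smooth partition of unity on `M` subordinate to the chart domains. -/
def chartPartition (n : ℕ) (M : Type*) [TopologicalSpace M]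
    [ChartedSpace (EuclideanSpace ℝ (Fin n)) M] [IsManifold (𝓡 n) ∞ M]
    [T2Space M] [CompactSpace M] : SmoothPartitionOfUnity M (𝓡 n) M Set.univ :=
  (SmoothPartitionOfUnity.exists_isSubordinate_chartAt_source (𝓡 n) M).choose

theorem chartPartition_isSubordinate [T2Space M] [CompactSpace M] :
    (chartPartition n M).IsSubordinate
      (fun c => (chartAt (EuclideanSpace ℝ (Fin n)) c).source) :=
  (SmoothPartitionOfUnity.exists_isSubordinate_chartAt_source (𝓡 n) M).choose_spec

variable [MeasurableSpace M]

/-- The measure `√det(gᵢⱼ) dy` of the chart at `c`, carried to `M`. -/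
def chartMeasure (g : Metric n M) (c : M) : Measure M :=
  Measure.map (extChartAt (𝓡 n) c).symm
    ((volume.restrict (extChartAt (𝓡 n) c).target).withDensity
      fun y => ENNReal.ofReal (density g c y))

variable [T2Space M] [CompactSpace M]

/-- The Riemannian volume measure `dν`, glued from the chart measures by a partition of unity. -/
def riemannianVolume (g : Metric n M) : Measure M :=
  Measure.sum fun c : M =>
    (chartMeasure g c).withDensity fun x => ENNReal.ofReal (chartPartition n M c x)

/-- The weighted volume measure `dμ = e^{-f} dν`. -/
def weightedVolume (g : Metric n M) (f : M → ℝ) : Measure M :=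
  (riemannianVolume g).withDensity fun x => ENNReal.ofReal (Real.exp (-f x))

/-- `I(t) = ∫ |u|² dμ`. -/
def energyI {m : ℕ} (g : Metric n M) (f : M → ℝ)
    (u : M → ℝ → EuclideanSpace ℝ (Fin m)) (t : ℝ) : ℝ :=
  ∫ x, ‖u x t‖ ^ 2 ∂(weightedVolume g f)

/-- `D(t) = - ∫ T(∇u, ∇u) dμ`, where `T(∇u, ∇u)` is summed over the components of `u`. -/
def energyD {m : ℕ} (g : Metric n M) (f : M → ℝ)
    (T : ∀ x : M, TangentSpace (𝓡 n) x →L[ℝ] TangentSpace (𝓡 n) x)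
    (u : M → ℝ → EuclideanSpace ℝ (Fin m)) (t : ℝ) : ℝ :=
  - ∫ x, ∑ j : Fin m,
      g.inner x (T x (grad g (fun y => u y t j) x)) (grad g (fun y => u y t j) x)
      ∂(weightedVolume g f)

/-- The parabolic frequency `U(t) = D(t) / I(t)`. -/
def frequency {m : ℕ} (g : Metric n M) (f : M → ℝ)
    (T : ∀ x : M, TangentSpace (𝓡 n) x →L[ℝ] TangentSpace (𝓡 n) x)
    (u : M → ℝ → EuclideanSpace ℝ (Fin m)) (t : ℝ) : ℝ :=
  energyD g f T u t / energyI g f u t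

end Measure

/-- `u` is a smooth solution on `M × [a, b]` of `u_t - 𝓛 u = φ(t) u`. -/
structure IsHeatSolution {m : ℕ} (g : Metric n M) (f : M → ℝ)
    (T : ∀ x : M, TangentSpace (𝓡 n) x →L[ℝ] TangentSpace (𝓡 n) x)
    (φ : ℝ → ℝ) (a b : ℝ) (u : M → ℝ → EuclideanSpace ℝ (Fin m)) : Prop where
  smooth : ContMDiffOn ((𝓡 n).prod 𝓘(ℝ, ℝ)) 𝓘(ℝ, EuclideanSpace ℝ (Fin m)) ∞
    (fun p : M × ℝ => u p.1 p.2) (Set.univ ×ˢ Set.Icc a b)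
  equation : ∀ x, ∀ t ∈ Set.Icc a b,
    derivWithin (fun s => u x s) (Set.Icc a b) t - diffusionVec g f T (fun y => u y t) x
      = φ t • u x t

end Geometry

end WeightedManifold

end

/-! Write `L` for the weighted operator and `E = ∫ |Lu|² dμ`. Green's formula makes `L` self-adjoint
for `dμ` and gives `D = ∫ ⟨u, Lu⟩ dμ ≤ 0`. Along a solution `I' = 2D + 2φI` and `D' = 2E + 2φD`, so
the `φ` terms cancel in `U' = 2(IE - D²)/I²`, which is nonnegative by Cauchy–Schwarz. If `U` is
constant then equality holds, hence `∫ |Lu - Uu|² dμ = E - 2UD + U²I = 0` and `Lu = Uu` pointwise;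
the equation becomes a linear ODE in `t` at each point. Finally `(log I)' = 2U + 2φ`, which is
nondecreasing when `φ` is.

Positivity of `I` has to come first (`energy_pos`). Backwards from a time where `I > 0` it follows
from `I' ≤ 2(sup |φ|) I`, since `D ≤ 0`. Forwards, up to a hypothetical first zero of `I`,
monotonicity of `U` bounds `I'/I` from below, so `I` cannot reach zero.

`D` is differentiated without commuting time and space derivatives: self-adjointness gives `D(t) -
D(s) = ∫ ⟨u(t) - u(s), Lu(t) + Lu(s)⟩ dμ`, and `hasDerivWithinAt_of_sub_eq_integral_inner` then
needs only joint continuity of `Lu`, which the equation supplies as `u_t - φu`.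

The geometric input is the divergence theorem for a divergence and a volume defined through charts.
The volume restricts to each chart measure by change of variables
(`riemannianVolume_restrict_source`); the divergence theorem for functions supported in one chart is
Euclidean integration by parts; chart independence of the divergence is deduced from it weakly, and
a partition of unity globalises (`IsC1Field.integral_mul_divergence`). -/

noncomputable section

namespace WeightedManifold

set_option linter.unusedSectionVars false

/-! ### Coordinate frames and the metric matrix. -/

section Coordinates

variable {n : ℕ} {M : Type*} [TopologicalSpace M]
  [ChartedSpace (EuclideanSpace ℝ (Fin n)) M] [IsManifold (𝓡 n) ∞ M]

theorem isOpen_target (c : M) : IsOpen (extChartAt (𝓡 n) c).target :=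
  isOpen_extChartAt_target c

theorem contMDiffAt_extChartAt_symm {c : M} {y : EuclideanSpace ℝ (Fin n)}
    (hy : y ∈ (extChartAt (𝓡 n) c).target) :
    ContMDiffAt 𝓘(ℝ, EuclideanSpace ℝ (Fin n)) (𝓡 n) ∞ (extChartAt (𝓡 n) c).symm y :=
  (contMDiffOn_extChartAt_symm c).contMDiffAt ((isOpen_target c).mem_nhds hy)

theorem mdifferentiableAt_extChartAt_symm {c : M} {y : EuclideanSpace ℝ (Fin n)}
    (hy : y ∈ (extChartAt (𝓡 n) c).target) :
    MDifferentiableAt 𝓘(ℝ, EuclideanSpace ℝ (Fin n)) (𝓡 n) (extChartAt (𝓡 n) c).symm y :=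
  (contMDiffAt_extChartAt_symm hy).mdifferentiableAt (by simp)

theorem mdifferentiableAt_extChartAt_of_mem {c x : M} (hx : x ∈ (extChartAt (𝓡 n) c).source) :
    MDifferentiableAt (𝓡 n) 𝓘(ℝ, EuclideanSpace ℝ (Fin n)) (extChartAt (𝓡 n) c) x :=
  mdifferentiableAt_extChartAt (by simpa using hx)

theorem mfderiv_extChartAt_comp_symm {c : M} {y : EuclideanSpace ℝ (Fin n)}
    (hy : y ∈ (extChartAt (𝓡 n) c).target) (v : EuclideanSpace ℝ (Fin n)) :
    mfderiv (𝓡 n) 𝓘(ℝ, EuclideanSpace ℝ (Fin n)) (extChartAt (𝓡 n) c)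
      ((extChartAt (𝓡 n) c).symm y)
      (mfderiv 𝓘(ℝ, EuclideanSpace ℝ (Fin n)) (𝓡 n) (extChartAt (𝓡 n) c).symm y v) = v := by
  have h := mfderiv_comp_apply y
    (mdifferentiableAt_extChartAt_of_mem ((extChartAt (𝓡 n) c).map_target hy))
    (mdifferentiableAt_extChartAt_symm hy) v
  rw [← h]
  have h2 : (extChartAt (𝓡 n) c ∘ (extChartAt (𝓡 n) c).symm) =ᶠ[nhds y] id := by
    filter_upwards [(isOpen_target c).mem_nhds hy] with z hz
    exact (extChartAt (𝓡 n) c).right_inv hz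
  rw [h2.mfderiv_eq, mfderiv_id]
  rfl

theorem mfderiv_extChartAt_symm_comp {c : M} {y : EuclideanSpace ℝ (Fin n)}
    (hy : y ∈ (extChartAt (𝓡 n) c).target)
    (v : TangentSpace (𝓡 n) ((extChartAt (𝓡 n) c).symm y)) :
    mfderiv 𝓘(ℝ, EuclideanSpace ℝ (Fin n)) (𝓡 n) (extChartAt (𝓡 n) c).symm y
      (mfderiv (𝓡 n) 𝓘(ℝ, EuclideanSpace ℝ (Fin n)) (extChartAt (𝓡 n) c)
        ((extChartAt (𝓡 n) c).symm y) v) = v := by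
  -- Tangent spaces of `M` unfold to the model space, so both differentials are endomorphisms of one
  -- finite-dimensional space, where a one-sided inverse is two-sided.
  set A : EuclideanSpace ℝ (Fin n) →ₗ[ℝ] EuclideanSpace ℝ (Fin n) :=
    (mfderiv 𝓘(ℝ, EuclideanSpace ℝ (Fin n)) (𝓡 n) (extChartAt (𝓡 n) c).symm y).toLinearMap with hA
  set B : EuclideanSpace ℝ (Fin n) →ₗ[ℝ] EuclideanSpace ℝ (Fin n) :=
    (mfderiv (𝓡 n) 𝓘(ℝ, EuclideanSpace ℝ (Fin n)) (extChartAt (𝓡 n) c)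
        ((extChartAt (𝓡 n) c).symm y)).toLinearMap with hB
  have h1 : B * A = 1 := by
    ext1 w
    exact mfderiv_extChartAt_comp_symm hy w
  have h2 : A * B = 1 := mul_eq_one_comm.mp h1
  exact LinearMap.congr_fun h2 v

/-- The coordinates of a vector determine it in the coordinate basis. -/
theorem sum_component_smul_coordVec {c : M} {y : EuclideanSpace ℝ (Fin n)}
    (hy : y ∈ (extChartAt (𝓡 n) c).target) (X : ∀ x : M, TangentSpace (𝓡 n) x) :
    ∑ i, component X c i y • coordVec c y i = X ((extChartAt (𝓡 n) c).symm y) := by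
  rw [← mfderiv_extChartAt_symm_comp hy (X ((extChartAt (𝓡 n) c).symm y))]
  set w : EuclideanSpace ℝ (Fin n) := mfderiv (𝓡 n) 𝓘(ℝ, EuclideanSpace ℝ (Fin n))
    (extChartAt (𝓡 n) c) ((extChartAt (𝓡 n) c).symm y) (X ((extChartAt (𝓡 n) c).symm y)) with hw
  have : w = ∑ i, w i • EuclideanSpace.single i (1 : ℝ) := by
    have := (EuclideanSpace.basisFun (Fin n) ℝ).sum_repr w
    simpa using this.symm
  rw [this]
  erw [map_sum]
  refine Finset.sum_congr rfl fun i _ => ?_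
  erw [map_smul]
  rfl

theorem component_eq_of_eq_sum {c : M} {y : EuclideanSpace ℝ (Fin n)}
    (hy : y ∈ (extChartAt (𝓡 n) c).target) (X : ∀ x : M, TangentSpace (𝓡 n) x) (a : Fin n → ℝ)
    (h : X ((extChartAt (𝓡 n) c).symm y) = ∑ i, a i • coordVec c y i) (i : Fin n) :
    component X c i y = a i := by
  have key : mfderiv (𝓡 n) 𝓘(ℝ, EuclideanSpace ℝ (Fin n)) (extChartAt (𝓡 n) c)
      ((extChartAt (𝓡 n) c).symm y) (X ((extChartAt (𝓡 n) c).symm y))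
      = ∑ j, a j • EuclideanSpace.single j (1 : ℝ) := by
    rw [h]
    erw [map_sum]
    refine Finset.sum_congr rfl fun j _ => ?_
    erw [map_smul]
    congr 1
    exact mfderiv_extChartAt_comp_symm hy _
  have : component X c i y = (∑ j, a j • EuclideanSpace.single j (1 : ℝ) :
      EuclideanSpace ℝ (Fin n)) i := congrArg (fun w : EuclideanSpace ℝ (Fin n) => w i) key
  rw [this]
  simp [Pi.single_apply]

/-- The field is the tangent map of the inverse chart applied to a constant section of the tangent
bundle of the model space. -/
theorem contMDiffOn_coordVec (c : M) (i : Fin n) :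
    ContMDiffOn 𝓘(ℝ, EuclideanSpace ℝ (Fin n)) ((𝓡 n).prod 𝓘(ℝ, EuclideanSpace ℝ (Fin n))) ∞
      (fun y => TotalSpace.mk' (EuclideanSpace ℝ (Fin n)) (E := fun x : M => TangentSpace (𝓡 n) x)
        ((extChartAt (𝓡 n) c).symm y) (coordVec c y i)) (extChartAt (𝓡 n) c).target := by
  have h := (contMDiffOn_extChartAt_symm (I := 𝓡 n) (n := ∞) c).contMDiffOn_tangentMapWithin
    (m := ∞) (by simp) (isOpen_target c).uniqueMDiffOn
  have h2 : ContMDiff 𝓘(ℝ, EuclideanSpace ℝ (Fin n)) 𝓘(ℝ, EuclideanSpace ℝ (Fin n)).tangent ∞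
      (fun y : EuclideanSpace ℝ (Fin n) => (⟨y, EuclideanSpace.single i (1 : ℝ)⟩ :
        TangentBundle 𝓘(ℝ, EuclideanSpace ℝ (Fin n)) (EuclideanSpace ℝ (Fin n)))) :=
    contMDiff_vectorSpace_iff_contDiff.2 contDiff_const
  refine (h.comp h2.contMDiffOn (fun y hy => hy)).congr fun y hy => ?_
  simp only [Function.comp, tangentMapWithin, coordVec]
  rw [mfderivWithin_of_isOpen (isOpen_target c) hy]

theorem contDiffOn_gram (g : Metric n M) (c : M) (i j : Fin n) :
    ContDiffOn ℝ ∞ (fun y => gram g c y i j) (extChartAt (𝓡 n) c).target := by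
  have hg := g.contMDiff.comp_contMDiffOn (contMDiffOn_extChartAt_symm (I := 𝓡 n) (n := ∞) c)
  have h := ContMDiffOn.clm_bundle_apply₂ (F₁ := EuclideanSpace ℝ (Fin n))
    (F₂ := EuclideanSpace ℝ (Fin n)) (F₃ := ℝ) (E₃ := Bundle.Trivial M ℝ)
    hg (contMDiffOn_coordVec c i) (contMDiffOn_coordVec c j)
  exact fun y hy => contMDiffWithinAt_iff_contDiffWithinAt.1
    (contMDiffWithinAt_totalSpace.1 (h y hy)).2

end Coordinates

/-! ### Smooth dependence of determinants and inverse matrices. -/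

section MatrixSmoothness

variable {ι F : Type*} [Fintype ι] [DecidableEq ι] [NormedAddCommGroup F] [NormedSpace ℝ F]
  {k : WithTop ℕ∞} {s : Set F} {A : F → Matrix ι ι ℝ}

theorem contDiffOn_matrix_det (hA : ∀ i j, ContDiffOn ℝ k (fun y => A y i j) s) :
    ContDiffOn ℝ k (fun y => (A y).det) s := by
  simp only [Matrix.det_apply]
  refine ContDiffOn.sum fun σ _ => ?_
  exact ContDiffOn.const_smul _ (contDiffOn_prod fun i _ => hA _ _)

/-- Cramer's rule: each entry is the inverse of the determinant times the determinant of `A` with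
one row replaced by a constant basis vector. -/
theorem contDiffOn_matrix_inv (hA : ∀ i j, ContDiffOn ℝ k (fun y => A y i j) s)
    (hdet : ∀ y ∈ s, (A y).det ≠ 0) (i j : ι) :
    ContDiffOn ℝ k (fun y => (A y)⁻¹ i j) s := by
  simp only [Matrix.inv_def, Matrix.smul_apply, Ring.inverse_eq_inv', smul_eq_mul,
    Matrix.adjugate_apply]
  refine ((contDiffOn_matrix_det hA).inv hdet).mul (contDiffOn_matrix_det fun k l => ?_)
  by_cases hk : k = j
  · subst hk
    simpa [Matrix.updateRow_self] using contDiffOn_const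
  · simpa [Matrix.updateRow_ne hk] using hA k l

end MatrixSmoothness

/-! ### Volume density, gradient and tensor in coordinates. -/

section Coordinates

variable {n : ℕ} {M : Type*} [TopologicalSpace M]
  [ChartedSpace (EuclideanSpace ℝ (Fin n)) M] [IsManifold (𝓡 n) ∞ M]

theorem coordVec_eq_zero_of_sum {c : M} {y : EuclideanSpace ℝ (Fin n)}
    (hy : y ∈ (extChartAt (𝓡 n) c).target) (a : Fin n → ℝ)
    (h : ∑ i, a i • coordVec c y i = 0) : a = 0 := by
  funext i
  have h1 := component_eq_of_eq_sum hy (fun _ => 0) a h.symm i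
  have h2 := component_eq_of_eq_sum hy (fun _ => 0) (0 : Fin n → ℝ)
    (Finset.sum_eq_zero fun _ _ => zero_smul ℝ _).symm i
  rw [← h1, h2]

theorem inner_sum_smul_coordVec (g : Metric n M) (c : M) (y : EuclideanSpace ℝ (Fin n))
    (a b : Fin n → ℝ) :
    g.inner _ (∑ i, a i • coordVec c y i) (∑ j, b j • coordVec c y j) =
      ∑ i, ∑ j, a i * b j * gram g c y i j := by
  rw [Finset.sum_comm]
  simp only [map_sum, map_smul, sum_apply, smul_apply,
    smul_eq_mul, gram, Matrix.of_apply]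
  refine Finset.sum_congr rfl fun i _ => ?_
  rw [Finset.mul_sum]
  refine Finset.sum_congr rfl fun j _ => by ring

theorem posDef_gram (g : Metric n M) {c : M} {y : EuclideanSpace ℝ (Fin n)}
    (hy : y ∈ (extChartAt (𝓡 n) c).target) : (gram g c y).PosDef := by
  refine Matrix.PosDef.of_dotProduct_mulVec_pos ?_ fun a ha => ?_
  · exact Matrix.IsHermitian.ext fun i j => g.symm _ _ _
  · have hne : (∑ i, a i • coordVec c y i) ≠ 0 :=
      fun h => ha (coordVec_eq_zero_of_sum hy a h)
    have := g.pos _ _ hne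
    rw [inner_sum_smul_coordVec] at this
    have e : dotProduct (star a) ((gram g c y).mulVec a) = ∑ i, ∑ j, a i * a j * gram g c y i j := by
      simp only [dotProduct, Matrix.mulVec, Pi.star_apply, star_trivial, Finset.mul_sum]
      exact Finset.sum_congr rfl fun i _ => Finset.sum_congr rfl fun j _ => by ring
    rw [e]
    exact this

theorem det_gram_pos (g : Metric n M) {c : M} {y : EuclideanSpace ℝ (Fin n)}
    (hy : y ∈ (extChartAt (𝓡 n) c).target) : 0 < (gram g c y).det :=
  (posDef_gram g hy).det_pos

theorem density_pos (g : Metric n M) {c : M} {y : EuclideanSpace ℝ (Fin n)}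
    (hy : y ∈ (extChartAt (𝓡 n) c).target) : 0 < density g c y :=
  Real.sqrt_pos.2 (det_gram_pos g hy)

theorem contDiffOn_density (g : Metric n M) (c : M) :
    ContDiffOn ℝ ∞ (density g c) (extChartAt (𝓡 n) c).target :=
  (contDiffOn_matrix_det (contDiffOn_gram g c)).sqrt fun _ hy => (det_gram_pos g hy).ne'

theorem contDiffOn_comp_extChartAt_symm {F : Type*} [NormedAddCommGroup F] [NormedSpace ℝ F]
    {k : WithTop ℕ∞} (hk : k ≤ ∞)
    {w : M → F} (hw : ContMDiff (𝓡 n) 𝓘(ℝ, F) k w) (c : M) :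
    ContDiffOn ℝ k (fun y => w ((extChartAt (𝓡 n) c).symm y)) (extChartAt (𝓡 n) c).target :=
  contMDiffOn_iff_contDiffOn.1
    (hw.comp_contMDiffOn ((contMDiffOn_extChartAt_symm (n := ∞) c).of_le hk))

theorem fderiv_comp_extChartAt_symm {w : M → ℝ} {c : M} {y : EuclideanSpace ℝ (Fin n)}
    (hy : y ∈ (extChartAt (𝓡 n) c).target)
    (hw : MDifferentiableAt (𝓡 n) 𝓘(ℝ, ℝ) w ((extChartAt (𝓡 n) c).symm y)) (i : Fin n) :
    fderiv ℝ (fun z => w ((extChartAt (𝓡 n) c).symm z)) y (EuclideanSpace.single i (1 : ℝ)) =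
      mfderiv (𝓡 n) 𝓘(ℝ, ℝ) w ((extChartAt (𝓡 n) c).symm y) (coordVec c y i) := by
  have h := mfderiv_comp_apply y hw (mdifferentiableAt_extChartAt_symm hy)
    (EuclideanSpace.single i (1 : ℝ))
  rw [mfderiv_eq_fderiv] at h
  exact h

theorem inner_grad (g : Metric n M) (w : M → ℝ) (x : M) (v : TangentSpace (𝓡 n) x) :
    g.inner x (grad g w x) v = mfderiv (𝓡 n) 𝓘(ℝ, ℝ) w x v :=
  LinearMap.BilinForm.apply_toDual_symm_apply (B := bilin g x)
    (hB := bilin_nondegenerate g x) _ v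

/-- The differential of `w` applied to a vector field, in coordinates. -/
theorem mfderiv_apply_eq_sum {w : M → ℝ} {c : M} {y : EuclideanSpace ℝ (Fin n)}
    (hy : y ∈ (extChartAt (𝓡 n) c).target)
    (hw : MDifferentiableAt (𝓡 n) 𝓘(ℝ, ℝ) w ((extChartAt (𝓡 n) c).symm y))
    (X : ∀ x : M, TangentSpace (𝓡 n) x) :
    mfderiv (𝓡 n) 𝓘(ℝ, ℝ) w ((extChartAt (𝓡 n) c).symm y) (X ((extChartAt (𝓡 n) c).symm y)) =
      ∑ i, fderiv ℝ (fun z => w ((extChartAt (𝓡 n) c).symm z)) y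
        (EuclideanSpace.single i (1 : ℝ)) * component X c i y := by
  rw [← sum_component_smul_coordVec hy X, map_sum]
  refine Finset.sum_congr rfl fun i _ => ?_
  rw [fderiv_comp_extChartAt_symm hy hw, map_smul]
  exact mul_comm (component X c i y) _

/-- Pairing the gradient with each coordinate field gives a linear system with matrix `gram`, which
is then inverted. -/
theorem component_grad (g : Metric n M) {w : M → ℝ} {c : M} {y : EuclideanSpace ℝ (Fin n)}
    (hy : y ∈ (extChartAt (𝓡 n) c).target)
    (hw : MDifferentiableAt (𝓡 n) 𝓘(ℝ, ℝ) w ((extChartAt (𝓡 n) c).symm y)) (i : Fin n) :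
    component (grad g w) c i y = ∑ j, (gram g c y)⁻¹ i j *
      fderiv ℝ (fun z => w ((extChartAt (𝓡 n) c).symm z)) y
        (EuclideanSpace.single j (1 : ℝ)) := by
  have h : (gram g c y).mulVec (fun i => component (grad g w) c i y) = fun j =>
      fderiv ℝ (fun z => w ((extChartAt (𝓡 n) c).symm z)) y
        (EuclideanSpace.single j (1 : ℝ)) := by
    funext j
    rw [fderiv_comp_extChartAt_symm hy hw, ← inner_grad g w,
      ← sum_component_smul_coordVec hy (grad g w),
      g.symm]
    simp only [map_sum, map_smul, Matrix.mulVec, dotProduct, gram, Matrix.of_apply, smul_eq_mul]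
    exact Finset.sum_congr rfl fun k _ => mul_comm _ _
  have h2 := congrArg ((gram g c y)⁻¹.mulVec) h
  rw [Matrix.mulVec_mulVec, Matrix.nonsing_inv_mul _ (det_gram_pos g hy).ne'.isUnit,
    Matrix.one_mulVec] at h2
  exact congrFun h2 i

/-- The entries of the matrix of `T` in the coordinate basis. -/
def tensorMatrix (T : ∀ x : M, TangentSpace (𝓡 n) x →L[ℝ] TangentSpace (𝓡 n) x) (c : M)
    (y : EuclideanSpace ℝ (Fin n)) (i j : Fin n) : ℝ :=
  (show EuclideanSpace ℝ (Fin n) from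
    mfderiv (𝓡 n) 𝓘(ℝ, EuclideanSpace ℝ (Fin n)) (extChartAt (𝓡 n) c)
      ((extChartAt (𝓡 n) c).symm y) (T ((extChartAt (𝓡 n) c).symm y) (coordVec c y j))) i

/-- `T` applied to a coordinate field is smooth along the inverse chart; the tangent map of the
chart carries it to the model space, where its components are read off. -/
theorem contDiffOn_tensorMatrix {g : Metric n M}
    {T : ∀ x : M, TangentSpace (𝓡 n) x →L[ℝ] TangentSpace (𝓡 n) x}
    (hT : IsSymmPosDefTensor g T) (c : M) (i j : Fin n) :
    ContDiffOn ℝ ∞ (fun y => tensorMatrix T c y i j) (extChartAt (𝓡 n) c).target := by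
  have h1 := hT.smooth.comp_contMDiffOn (contMDiffOn_extChartAt_symm (I := 𝓡 n) (n := ∞) c)
  have h2 := ContMDiffOn.clm_bundle_apply h1 (contMDiffOn_coordVec c j)
  have h3 := (contMDiffOn_extChartAt (I := 𝓡 n) (n := ∞) (x := c)).contMDiffOn_tangentMapWithin
    (m := ∞) (by simp) (chartAt (EuclideanSpace ℝ (Fin n)) c).open_source.uniqueMDiffOn
  have h4 := h3.comp h2 fun y hy => by
    simpa using (extChartAt (𝓡 n) c).map_target hy
  have h5 := (contMDiff_snd_tangentBundle_modelSpace (EuclideanSpace ℝ (Fin n))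
    𝓘(ℝ, EuclideanSpace ℝ (Fin n)) (n := ∞)).comp_contMDiffOn h4
  have h6 := contMDiffOn_iff_contDiffOn.1 h5
  refine ((EuclideanSpace.proj (𝕜 := ℝ) i).contDiff.comp_contDiffOn h6).congr fun y hy => ?_
  simp only [Function.comp, tangentMapWithin, tensorMatrix]
  rw [mfderivWithin_of_isOpen (chartAt (EuclideanSpace ℝ (Fin n)) c).open_source
    (by simpa using (extChartAt (𝓡 n) c).map_target hy)]
  rfl

theorem component_tensor_apply
    (T : ∀ x : M, TangentSpace (𝓡 n) x →L[ℝ] TangentSpace (𝓡 n) x)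
    {c : M} {y : EuclideanSpace ℝ (Fin n)}
    (hy : y ∈ (extChartAt (𝓡 n) c).target) (X : ∀ x : M, TangentSpace (𝓡 n) x) (i : Fin n) :
    component (fun x => T x (X x)) c i y = ∑ j, tensorMatrix T c y i j * component X c j y := by
  let Λ : TangentSpace (𝓡 n) ((extChartAt (𝓡 n) c).symm y) →L[ℝ] ℝ :=
    (EuclideanSpace.proj (𝕜 := ℝ) i : EuclideanSpace ℝ (Fin n) →L[ℝ] ℝ).comp
      ((mfderiv (𝓡 n) 𝓘(ℝ, EuclideanSpace ℝ (Fin n)) (extChartAt (𝓡 n) c)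
      ((extChartAt (𝓡 n) c).symm y)).comp (T ((extChartAt (𝓡 n) c).symm y)))
  have h : component (fun x => T x (X x)) c i y = Λ (X ((extChartAt (𝓡 n) c).symm y)) := rfl
  rw [h, ← sum_component_smul_coordVec hy X, map_sum]
  refine Finset.sum_congr rfl fun j _ => ?_
  rw [map_smul, mul_comm]
  rfl

/-- If `w` is smooth then so are the components of `T ∇w` in each chart. -/
theorem contDiffOn_component_tensor_grad {g : Metric n M}
    {T : ∀ x : M, TangentSpace (𝓡 n) x →L[ℝ] TangentSpace (𝓡 n) x}
    (hT : IsSymmPosDefTensor g T) {w : M → ℝ} (hw : ContMDiff (𝓡 n) 𝓘(ℝ, ℝ) ∞ w)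
    (c : M) (i : Fin n) :
    ContDiffOn ℝ ∞ (component (fun x => T x (grad g w x)) c i) (extChartAt (𝓡 n) c).target := by
  have hW : ∀ j, ContDiffOn ℝ ∞ (fun y => fderiv ℝ (fun z => w ((extChartAt (𝓡 n) c).symm z)) y
        (EuclideanSpace.single j (1 : ℝ))) (extChartAt (𝓡 n) c).target := fun j =>
    ((contDiffOn_comp_extChartAt_symm le_rfl hw c).fderiv_of_isOpen (isOpen_target c)
      (m := ∞) (by simp)).clm_apply contDiffOn_const
  have hG : ∀ j, ContDiffOn ℝ ∞ (component (grad g w) c j) (extChartAt (𝓡 n) c).target := fun j =>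
    (ContDiffOn.sum fun k _ => (contDiffOn_matrix_inv (contDiffOn_gram g c)
      (fun y hy => (det_gram_pos g hy).ne') j k).mul (hW k)).congr fun y hy =>
        component_grad g hy (hw.mdifferentiable (by simp) _) j
  exact (ContDiffOn.sum fun j _ => (contDiffOn_tensorMatrix hT c i j).mul (hG j)).congr
    fun y hy => component_tensor_apply T hy _ i

end Coordinates

/-! ### Transition maps and the transformation law of the density. -/

section ChangeOfCharts

variable {n : ℕ} {M : Type*} [TopologicalSpace M]
  [ChartedSpace (EuclideanSpace ℝ (Fin n)) M] [IsManifold (𝓡 n) ∞ M]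

/-- The transition map from the chart at `c` to the chart at `d`. -/
def transition (c d : M) (y : EuclideanSpace ℝ (Fin n)) : EuclideanSpace ℝ (Fin n) :=
  extChartAt (𝓡 n) d ((extChartAt (𝓡 n) c).symm y)

theorem transition_mem {c d : M} {y : EuclideanSpace ℝ (Fin n)}
    (hd : (extChartAt (𝓡 n) c).symm y ∈ (extChartAt (𝓡 n) d).source) :
    transition c d y ∈ (extChartAt (𝓡 n) d).target :=
  (extChartAt (𝓡 n) d).map_source hd

theorem extChartAt_symm_transition {c d : M} {y : EuclideanSpace ℝ (Fin n)}
    (hd : (extChartAt (𝓡 n) c).symm y ∈ (extChartAt (𝓡 n) d).source) :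
    (extChartAt (𝓡 n) d).symm (transition c d y) = (extChartAt (𝓡 n) c).symm y :=
  (extChartAt (𝓡 n) d).left_inv hd

theorem mdifferentiableAt_transition {c d : M} {y : EuclideanSpace ℝ (Fin n)}
    (hy : y ∈ (extChartAt (𝓡 n) c).target)
    (hd : (extChartAt (𝓡 n) c).symm y ∈ (extChartAt (𝓡 n) d).source) :
    MDifferentiableAt 𝓘(ℝ, EuclideanSpace ℝ (Fin n)) 𝓘(ℝ, EuclideanSpace ℝ (Fin n))
      (transition c d) y :=
  (mdifferentiableAt_extChartAt_of_mem hd).comp y (mdifferentiableAt_extChartAt_symm hy)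

theorem eventually_symm_mem_source {c d : M} {y : EuclideanSpace ℝ (Fin n)}
    (hy : y ∈ (extChartAt (𝓡 n) c).target)
    (hd : (extChartAt (𝓡 n) c).symm y ∈ (extChartAt (𝓡 n) d).source) :
    ∀ᶠ z in nhds y, (extChartAt (𝓡 n) c).symm z ∈ (extChartAt (𝓡 n) d).source :=
  (mdifferentiableAt_extChartAt_symm hy).continuousAt.eventually_mem
    ((isOpen_extChartAt_source d).mem_nhds hd)

/-- Chain rule: near `y` the inverse chart at `c` is the inverse chart at `d` after the transition
map. The two vectors sit over base points that are equal only propositionally, so they are compared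
in the model space. -/
theorem coordVec_eq_mfderiv_transition {c d : M} {y : EuclideanSpace ℝ (Fin n)}
    (hy : y ∈ (extChartAt (𝓡 n) c).target)
    (hd : (extChartAt (𝓡 n) c).symm y ∈ (extChartAt (𝓡 n) d).source) (i : Fin n) :
    (show EuclideanSpace ℝ (Fin n) from coordVec c y i) =
      show EuclideanSpace ℝ (Fin n) from
        mfderiv 𝓘(ℝ, EuclideanSpace ℝ (Fin n)) (𝓡 n) (extChartAt (𝓡 n) d).symm (transition c d y)
          (fderiv ℝ (transition c d) y (EuclideanSpace.single i (1 : ℝ))) := by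
  have h := mfderiv_comp_apply y (mdifferentiableAt_extChartAt_symm (transition_mem hd))
    (mdifferentiableAt_transition hy hd) (EuclideanSpace.single i (1 : ℝ))
  rw [mfderiv_eq_fderiv] at h
  have e : ((extChartAt (𝓡 n) d).symm ∘ transition c d) =ᶠ[nhds y]
      (extChartAt (𝓡 n) c).symm := by
    filter_upwards [eventually_symm_mem_source hy hd] with z hz
    exact extChartAt_symm_transition hz
  rw [e.mfderiv_eq] at h
  exact h

theorem inner_congr_base (g : Metric n M) {x x' : M} (h : x = x')
    (v w : EuclideanSpace ℝ (Fin n)) :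
    g.inner x (show TangentSpace (𝓡 n) x from v) (show TangentSpace (𝓡 n) x from w) =
      g.inner x' (show TangentSpace (𝓡 n) x' from v) (show TangentSpace (𝓡 n) x' from w) := by
  subst h; rfl

theorem mfderiv_symm_eq_sum (d : M) (y v : EuclideanSpace ℝ (Fin n)) :
    mfderiv 𝓘(ℝ, EuclideanSpace ℝ (Fin n)) (𝓡 n) (extChartAt (𝓡 n) d).symm y v =
      ∑ i, v i • coordVec d y i := by
  have : v = ∑ i, v i • EuclideanSpace.single i (1 : ℝ) := by
    simpa using ((EuclideanSpace.basisFun (Fin n) ℝ).sum_repr v).symm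
  conv_lhs => rw [this]
  erw [map_sum]
  refine Finset.sum_congr rfl fun i _ => ?_
  erw [map_smul]
  rfl

/-- The Jacobian matrix of the transition map. -/
def jacobian (c d : M) (y : EuclideanSpace ℝ (Fin n)) : Matrix (Fin n) (Fin n) ℝ :=
  Matrix.of fun k i => fderiv ℝ (transition c d) y (EuclideanSpace.single i (1 : ℝ)) k

theorem det_jacobian (c d : M) (y : EuclideanSpace ℝ (Fin n)) :
    (jacobian c d y).det = (fderiv ℝ (transition c d) y).det := by
  rw [ContinuousLinearMap.det, ← LinearMap.det_toMatrix (EuclideanSpace.basisFun (Fin n) ℝ).toBasis]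
  rfl

theorem gram_eq_jacobian_mul {c d : M} (g : Metric n M) {y : EuclideanSpace ℝ (Fin n)}
    (hy : y ∈ (extChartAt (𝓡 n) c).target)
    (hd : (extChartAt (𝓡 n) c).symm y ∈ (extChartAt (𝓡 n) d).source) :
    gram g c y = (jacobian c d y).transpose * gram g d (transition c d y) * jacobian c d y := by
  ext i j
  have h : gram g c y i j = g.inner ((extChartAt (𝓡 n) d).symm (transition c d y))
      (∑ k, jacobian c d y k i • coordVec d (transition c d y) k)
      (∑ k, jacobian c d y k j • coordVec d (transition c d y) k) := by
    have h1 := inner_congr_base g (extChartAt_symm_transition hd).symm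
      (show EuclideanSpace ℝ (Fin n) from coordVec c y i)
      (show EuclideanSpace ℝ (Fin n) from coordVec c y j)
    rw [coordVec_eq_mfderiv_transition hy hd i, coordVec_eq_mfderiv_transition hy hd j] at h1
    have h2 : ∀ i, ∑ k, jacobian c d y k i • coordVec d (transition c d y) k =
        mfderiv 𝓘(ℝ, EuclideanSpace ℝ (Fin n)) (𝓡 n) (extChartAt (𝓡 n) d).symm (transition c d y)
          (fderiv ℝ (transition c d) y (EuclideanSpace.single i (1 : ℝ))) := fun i =>
      (mfderiv_symm_eq_sum _ _ _).symm
    rw [h2, h2]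
    refine Eq.trans ?_ h1
    rw [← coordVec_eq_mfderiv_transition hy hd i, ← coordVec_eq_mfderiv_transition hy hd j]
    rfl
  rw [h, inner_sum_smul_coordVec]
  simp only [Matrix.mul_apply, Matrix.transpose_apply, Finset.sum_mul]
  rw [Finset.sum_comm]
  exact Finset.sum_congr rfl fun k _ => Finset.sum_congr rfl fun l _ => by ring

/-- The congruence of metric matrices contributes the square of the Jacobian determinant; its root
is the factor in the change of variables formula. -/
theorem density_eq_abs_det_mul {c d : M} (g : Metric n M) {y : EuclideanSpace ℝ (Fin n)}
    (hy : y ∈ (extChartAt (𝓡 n) c).target)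
    (hd : (extChartAt (𝓡 n) c).symm y ∈ (extChartAt (𝓡 n) d).source) :
    density g c y = |(fderiv ℝ (transition c d) y).det| * density g d (transition c d y) := by
  rw [density, gram_eq_jacobian_mul g hy hd, Matrix.det_mul, Matrix.det_mul,
    Matrix.det_transpose, density, ← Real.sqrt_sq_eq_abs, ← Real.sqrt_mul (sq_nonneg _),
    ← det_jacobian]
  congr 1
  ring

end ChangeOfCharts

/-! ### Measures carried by single charts. -/

section ChartMeasure

variable {n : ℕ} {M : Type*} [TopologicalSpace M]
  [ChartedSpace (EuclideanSpace ℝ (Fin n)) M] [IsManifold (𝓡 n) ∞ M]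
  [MeasurableSpace M] [BorelSpace M]

theorem aemeasurable_extChartAt_symm (c : M) :
    AEMeasurable (extChartAt (𝓡 n) c).symm (volume.restrict (extChartAt (𝓡 n) c).target) :=
  (continuousOn_extChartAt_symm c).aemeasurable (isOpen_target c).measurableSet

/-- The inverse chart is known to be continuous only on the target, so the preimage is taken in the
subtype and pushed forward. -/
theorem measurableSet_preimage_inter_target (c : M) {A : Set M} (hA : MeasurableSet A) :
    MeasurableSet ((extChartAt (𝓡 n) c).symm ⁻¹' A ∩ (extChartAt (𝓡 n) c).target) := by
  have h := (continuousOn_iff_continuous_domRestrict.1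
    (continuousOn_extChartAt_symm (I := 𝓡 n) c)).measurable hA
  have h2 := MeasurableSet.subtype_image (isOpen_target c).measurableSet h
  convert h2 using 1
  ext y
  simp only [Set.mem_inter_iff, Set.mem_preimage, Set.mem_image, Subtype.exists,
    Set.domRestrict_apply, exists_and_right, exists_eq_right]
  exact ⟨fun h => ⟨h.2, h.1⟩, fun ⟨h, h'⟩ => ⟨h', h⟩⟩

theorem chartMeasure_apply (g : Metric n M) (c : M) {A : Set M} (hA : MeasurableSet A) :
    chartMeasure g c A =
      ∫⁻ y in (extChartAt (𝓡 n) c).symm ⁻¹' A ∩ (extChartAt (𝓡 n) c).target,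
        ENNReal.ofReal (density g c y) := by
  rw [chartMeasure, Measure.map_apply_of_aemeasurable _ hA, withDensity_apply',
    Measure.restrict_restrict' (isOpen_target c).measurableSet]
  exact (aemeasurable_extChartAt_symm c).mono_ac (withDensity_absolutelyContinuous _ _)

/-- The transition map is injective on the coordinate image of `A`, so this is the change of
variables formula combined with `density_eq_abs_det_mul`. -/
theorem chartMeasure_apply_eq_of_subset (g : Metric n M) {c d : M} {A : Set M}
    (hA : MeasurableSet A) (hc : A ⊆ (extChartAt (𝓡 n) c).source)
    (hd : A ⊆ (extChartAt (𝓡 n) d).source) :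
    chartMeasure g c A = chartMeasure g d A := by
  rw [chartMeasure_apply g c hA, chartMeasure_apply g d hA]
  have himg : (extChartAt (𝓡 n) d).symm ⁻¹' A ∩ (extChartAt (𝓡 n) d).target =
      transition c d '' ((extChartAt (𝓡 n) c).symm ⁻¹' A ∩ (extChartAt (𝓡 n) c).target) := by
    ext z
    constructor
    · rintro ⟨hzA, hz⟩
      refine ⟨extChartAt (𝓡 n) c ((extChartAt (𝓡 n) d).symm z), ⟨?_, ?_⟩, ?_⟩
      · rw [Set.mem_preimage, (extChartAt (𝓡 n) c).left_inv (hc hzA)]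
        exact hzA
      · exact (extChartAt (𝓡 n) c).map_source (hc hzA)
      · rw [transition, (extChartAt (𝓡 n) c).left_inv (hc hzA), (extChartAt (𝓡 n) d).right_inv hz]
    · rintro ⟨y, ⟨hyA, hy⟩, rfl⟩
      have hyd : (extChartAt (𝓡 n) c).symm y ∈ (extChartAt (𝓡 n) d).source := hd hyA
      refine ⟨?_, transition_mem hyd⟩
      rw [Set.mem_preimage, extChartAt_symm_transition hyd]
      exact hyA
  have hS := measurableSet_preimage_inter_target (n := n) c hA
  rw [himg, lintegral_image_eq_lintegral_abs_det_fderiv_mul volume hS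
    (f' := fun y => fderiv ℝ (transition c d) y)]
  · refine setLIntegral_congr_fun hS fun y hy => ?_
    rw [density_eq_abs_det_mul g hy.2 (hd hy.1), ENNReal.ofReal_mul (abs_nonneg _)]
  · exact fun y hy => (mdifferentiableAt_iff_differentiableAt.1
      (mdifferentiableAt_transition hy.2 (hd hy.1))).hasFDerivAt.hasFDerivWithinAt
  · intro y hy z hz h
    have h1 := congrArg (extChartAt (𝓡 n) d).symm h
    rw [extChartAt_symm_transition (c := c) (d := d) (hd hy.1),
      extChartAt_symm_transition (c := c) (d := d) (hd hz.1)] at h1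
    exact (extChartAt (𝓡 n) c).symm.injOn hy.2 hz.2 h1

theorem chartMeasure_restrict_eq (g : Metric n M) {c d : M} {A : Set M}
    (hA : MeasurableSet A) (hc : A ⊆ (extChartAt (𝓡 n) c).source)
    (hd : A ⊆ (extChartAt (𝓡 n) d).source) :
    (chartMeasure g c).restrict A = (chartMeasure g d).restrict A := by
  ext B hB
  rw [Measure.restrict_apply hB, Measure.restrict_apply hB]
  exact chartMeasure_apply_eq_of_subset g (hB.inter hA) (Set.inter_subset_right.trans hc)
    (Set.inter_subset_right.trans hd)

theorem chartMeasure_restrict_source (g : Metric n M) (c : M) :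
    (chartMeasure g c).restrict (extChartAt (𝓡 n) c).source = chartMeasure g c := by
  refine Measure.restrict_eq_self_of_ae_mem ?_
  rw [ae_iff, ← Set.compl_def, chartMeasure_apply g c (isOpen_extChartAt_source c).measurableSet.compl]
  have : (extChartAt (𝓡 n) c).symm ⁻¹' (extChartAt (𝓡 n) c).sourceᶜ ∩
      (extChartAt (𝓡 n) c).target = ∅ := by
    ext y
    simp only [Set.mem_inter_iff, Set.mem_preimage, Set.mem_compl_iff, Set.mem_empty_iff_false,
      iff_false, not_and]
    exact fun h hy => h ((extChartAt (𝓡 n) c).map_target hy)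
  rw [this]
  simp

/-- Integration against the chart measure, in coordinates. -/
theorem integral_chartMeasure (g : Metric n M) (c : M) {h : M → ℝ}
    (hh : ContinuousOn h (extChartAt (𝓡 n) c).source) :
    ∫ x, h x ∂(chartMeasure g c) =
      ∫ y in (extChartAt (𝓡 n) c).target, density g c y * h ((extChartAt (𝓡 n) c).symm y) := by
  have hm : AEStronglyMeasurable h (chartMeasure g c) := by
    rw [← chartMeasure_restrict_source]
    exact hh.aestronglyMeasurable (isOpen_extChartAt_source c).measurableSet
  rw [chartMeasure] at hm ⊢
  rw [integral_map ((aemeasurable_extChartAt_symm c).mono_ac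
    (withDensity_absolutelyContinuous _ _)) hm, integral_withDensity_eq_integral_toReal_smul₀]
  · refine setIntegral_congr_fun (isOpen_target c).measurableSet fun y hy => ?_
    simp only [smul_eq_mul]
    rw [ENNReal.toReal_ofReal (density_pos g hy).le]
  · exact ((contDiffOn_density g c).continuousOn.aemeasurable
      (isOpen_target c).measurableSet).ennreal_ofReal
  · exact Filter.Eventually.of_forall fun _ => ENNReal.ofReal_lt_top

theorem chartMeasure_pos_of_isOpen (g : Metric n M) {c : M} {U : Set M} (hU : IsOpen U)
    {x : M} (hx : x ∈ U) (hc : x ∈ (extChartAt (𝓡 n) c).source) : 0 < chartMeasure g c U := by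
  rw [chartMeasure_apply g c hU.measurableSet]
  set S := (extChartAt (𝓡 n) c).symm ⁻¹' U ∩ (extChartAt (𝓡 n) c).target with hSdef
  have hS : IsOpen S := by
    rw [hSdef, Set.inter_comm]
    exact (continuousOn_extChartAt_symm c).isOpen_inter_preimage (isOpen_target c) hU
  have hne : S.Nonempty := ⟨extChartAt (𝓡 n) c x, by
    rw [Set.mem_preimage, (extChartAt (𝓡 n) c).left_inv hc]; exact hx,
    (extChartAt (𝓡 n) c).map_source hc⟩
  refine pos_iff_ne_zero.2 fun h0 => ?_
  have hm : AEMeasurable (fun y => ENNReal.ofReal (density g c y)) (volume.restrict S) :=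
    (((contDiffOn_density g c).continuousOn.mono Set.inter_subset_right).aemeasurable
      hS.measurableSet).ennreal_ofReal
  have h1 := (ae_restrict_iff' hS.measurableSet).1 ((lintegral_eq_zero_iff' hm).1 h0)
  have h2 : volume S = 0 := by
    refine measure_mono_null (fun y hy => ?_) (ae_iff.1 h1)
    simp only [Pi.zero_apply, ENNReal.ofReal_eq_zero, not_le, Set.mem_ofPred_eq, not_forall]
    exact ⟨hy, density_pos g hy.2⟩
  exact (hS.measure_pos volume hne).ne' h2

/-- Compact subsets of the chart domain have finite chart measure. -/
theorem chartMeasure_lt_top_of_isCompact (g : Metric n M) {c : M} {K : Set M} (hK : IsCompact K)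
    (hKm : MeasurableSet K) 
    (hc : K ⊆ (extChartAt (𝓡 n) c).source) : chartMeasure g c K < ⊤ := by
  rw [chartMeasure_apply g c hKm]
  have himg : (extChartAt (𝓡 n) c).symm ⁻¹' K ∩ (extChartAt (𝓡 n) c).target =
      extChartAt (𝓡 n) c '' K := by
    ext y
    constructor
    · exact fun h => ⟨_, h.1, (extChartAt (𝓡 n) c).right_inv h.2⟩
    · rintro ⟨x, hx, rfl⟩
      refine ⟨?_, (extChartAt (𝓡 n) c).map_source (hc hx)⟩
      rw [Set.mem_preimage, (extChartAt (𝓡 n) c).left_inv (hc hx)]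
      exact hx
  have hsub : extChartAt (𝓡 n) c '' K ⊆ (extChartAt (𝓡 n) c).target := by
    rw [← himg]; exact Set.inter_subset_right
  rw [himg]
  have hcomp : IsCompact (extChartAt (𝓡 n) c '' K) :=
    hK.image_of_continuousOn ((continuousOn_extChartAt c).mono hc)
  have hint := ((contDiffOn_density g c).continuousOn.mono hsub).integrableOn_compact (μ := volume) hcomp
  refine lt_of_le_of_lt (lintegral_mono fun y => ?_) hint.2
  exact Real.ofReal_le_enorm _

end ChartMeasure

/-! ### The glued Riemannian volume. -/

section RiemannianVolume

variable {n : ℕ} {M : Type*} [TopologicalSpace M]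
  [ChartedSpace (EuclideanSpace ℝ (Fin n)) M] [IsManifold (𝓡 n) ∞ M]
  [T2Space M] [CompactSpace M]

variable (n M) in
theorem finite_chartPartition_support :
    {c : M | (Function.support (chartPartition n M c)).Nonempty}.Finite :=
  (chartPartition n M).locallyFinite.finite_nonempty_of_compact

variable (n M) in
/-- The finitely many charts that enter the partition of unity. -/
def chartIndex : Finset M := (finite_chartPartition_support n M).toFinset

theorem chartPartition_eq_zero_of_notMem {c : M} (hc : c ∉ chartIndex n M) (x : M) :
    chartPartition n M c x = 0 := by
  by_contra h
  exact hc ((finite_chartPartition_support n M).mem_toFinset.2 ⟨x, h⟩)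

theorem sum_chartPartition (x : M) : ∑ c ∈ chartIndex n M, chartPartition n M c x = 1 := by
  rw [← (chartPartition n M).sum_eq_one (Set.mem_univ x)]
  refine (finsum_eq_sum_of_support_subset _ fun c hc => ?_).symm
  by_contra h
  exact hc (chartPartition_eq_zero_of_notMem h x)

theorem tsupport_chartPartition_subset (c : M) :
    tsupport (chartPartition n M c) ⊆ (extChartAt (𝓡 n) c).source := by
  rw [extChartAt_source]
  exact chartPartition_isSubordinate c

theorem chartPartition_eq_zero {c x : M} (hx : x ∉ (extChartAt (𝓡 n) c).source) :
    chartPartition n M c x = 0 :=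
  image_eq_zero_of_notMem_tsupport fun h => hx (tsupport_chartPartition_subset c h)

theorem contMDiff_chartPartition (c : M) :
    ContMDiff (𝓡 n) 𝓘(ℝ, ℝ) ∞ (chartPartition n M c) :=
  (chartPartition n M c).contMDiff

variable [MeasurableSpace M] [BorelSpace M]

theorem measurable_chartPartition (c : M) :
    Measurable fun x => ENNReal.ofReal (chartPartition n M c x) :=
  (contMDiff_chartPartition c).continuous.measurable.ennreal_ofReal

theorem riemannianVolume_apply (g : Metric n M) {A : Set M} (hA : MeasurableSet A) :
    riemannianVolume g A = ∑ c ∈ chartIndex n M,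
      ∫⁻ x in A, ENNReal.ofReal (chartPartition n M c x) ∂(chartMeasure g c) := by
  rw [riemannianVolume, Measure.sum_apply _ hA, tsum_eq_sum (s := chartIndex n M)]
  · exact Finset.sum_congr rfl fun c _ => withDensity_apply _ hA
  · intro c hc
    rw [withDensity_apply _ hA]
    simp [chartPartition_eq_zero_of_notMem hc]

/-- In the summand of the chart at `d` the chart measure can be replaced by that at `c`, since they
agree on the overlap; the weights then sum to one. -/
theorem riemannianVolume_apply_of_subset (g : Metric n M) {c : M} {A : Set M}
    (hA : MeasurableSet A) (hc : A ⊆ (extChartAt (𝓡 n) c).source) :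
    riemannianVolume g A = chartMeasure g c A := by
  rw [riemannianVolume_apply g hA]
  have key : ∀ d : M, ∫⁻ x in A, ENNReal.ofReal (chartPartition n M d x) ∂(chartMeasure g d) =
      ∫⁻ x in A, ENNReal.ofReal (chartPartition n M d x) ∂(chartMeasure g c) := by
    intro d
    have hO := (isOpen_extChartAt_source (I := 𝓡 n) d).measurableSet
    -- The weight vanishes off the chart at `d`, so under either measure only the overlap
    -- contributes.
    have hz : ∀ μ : Measure M, ∫⁻ x in A, ENNReal.ofReal (chartPartition n M d x) ∂μ =
        ∫⁻ x in A ∩ (extChartAt (𝓡 n) d).source, ENNReal.ofReal (chartPartition n M d x) ∂μ := by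
      intro μ
      rw [← lintegral_indicator hA, ← lintegral_indicator (hA.inter hO)]
      have hself : (extChartAt (𝓡 n) d).source.indicator
          (fun x => ENNReal.ofReal (chartPartition n M d x)) =
          fun x => ENNReal.ofReal (chartPartition n M d x) := by
        refine Set.indicator_eq_self.2 fun x hx => by_contra fun h => hx ?_
        simp only [chartPartition_eq_zero h, ENNReal.ofReal_zero]
      rw [← Set.indicator_indicator, hself]
    rw [hz, hz, chartMeasure_restrict_eq g (hA.inter hO) Set.inter_subset_right
      (Set.inter_subset_left.trans hc)]
  rw [Finset.sum_congr rfl fun d _ => key d,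
    ← lintegral_finsetSum _ fun d _ => measurable_chartPartition d]
  have h1 : ∀ x : M, ∑ d ∈ chartIndex n M, ENNReal.ofReal (chartPartition n M d x) = 1 := by
    intro x
    rw [← ENNReal.ofReal_sum_of_nonneg fun d _ => (chartPartition n M).nonneg d x,
      sum_chartPartition, ENNReal.ofReal_one]
  simp [h1]

theorem riemannianVolume_restrict_source (g : Metric n M) (c : M) :
    (riemannianVolume g).restrict (extChartAt (𝓡 n) c).source = chartMeasure g c := by
  have hO := (isOpen_extChartAt_source (I := 𝓡 n) c).measurableSet
  rw [← chartMeasure_restrict_source]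
  ext A hA
  rw [Measure.restrict_apply hA, Measure.restrict_apply hA]
  exact riemannianVolume_apply_of_subset g (hA.inter hO) Set.inter_subset_right

instance isFiniteMeasure_riemannianVolume (g : Metric n M) :
    IsFiniteMeasure (riemannianVolume g) := by
  constructor
  rw [riemannianVolume_apply g MeasurableSet.univ, ENNReal.sum_lt_top]
  intro c _
  set K := tsupport (chartPartition n M c)
  have hK : IsClosed K := isClosed_tsupport _
  calc ∫⁻ x in Set.univ, ENNReal.ofReal (chartPartition n M c x) ∂(chartMeasure g c)
      ≤ ∫⁻ x, K.indicator 1 x ∂(chartMeasure g c) := by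
        rw [Measure.restrict_univ]
        refine lintegral_mono fun x => ?_
        by_cases hx : x ∈ K
        · simpa [hx] using (chartPartition n M).le_one c x
        · simp [image_eq_zero_of_notMem_tsupport hx]
    _ = chartMeasure g c K := lintegral_indicator_one hK.measurableSet
    _ < ⊤ := chartMeasure_lt_top_of_isCompact g hK.isCompact hK.measurableSet
        (tsupport_chartPartition_subset c)

instance isOpenPosMeasure_riemannianVolume (g : Metric n M) :
    (riemannianVolume g).IsOpenPosMeasure := by
  constructor
  rintro U hU ⟨x, hx⟩ h0
  have hO := isOpen_extChartAt_source (I := 𝓡 n) x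
  have h1 : riemannianVolume g (U ∩ (extChartAt (𝓡 n) x).source) = 0 :=
    measure_mono_null Set.inter_subset_left h0
  rw [riemannianVolume_apply_of_subset g (hU.inter hO).measurableSet Set.inter_subset_right] at h1
  exact (chartMeasure_pos_of_isOpen g (hU.inter hO) ⟨hx, mem_extChartAt_source x⟩
    (mem_extChartAt_source x)).ne' h1

/-- The integral of a function supported in a chart domain, in coordinates. -/
theorem integral_riemannianVolume_of_chart (g : Metric n M) (c : M) {h : M → ℝ}
    (hh : ContinuousOn h (extChartAt (𝓡 n) c).source)
    (h0 : ∀ x ∉ (extChartAt (𝓡 n) c).source, h x = 0) :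
    ∫ x, h x ∂(riemannianVolume g) =
      ∫ y in (extChartAt (𝓡 n) c).target, density g c y * h ((extChartAt (𝓡 n) c).symm y) := by
  rw [← integral_chartMeasure g c hh, ← riemannianVolume_restrict_source,
    setIntegral_eq_integral_of_forall_compl_eq_zero h0]

theorem integrable_riemannianVolume_of_continuous (g : Metric n M) {F : Type*}
    [NormedAddCommGroup F] {h : M → F} (hh : Continuous h) :
    Integrable h (riemannianVolume g) :=
  hh.integrable_of_hasCompactSupport (HasCompactSupport.of_compactSpace h)

end RiemannianVolume

/-! ### Integration by parts in Euclidean space. -/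

section Euclidean

variable {F : Type*} [NormedAddCommGroup F] [NormedSpace ℝ F] [FiniteDimensional ℝ F]
  [MeasurableSpace F] [BorelSpace F]

/-- Integration by parts on an open set, against a function that vanishes off a compact subset. -/
theorem setIntegral_mul_fderiv_eq_neg {Ω K : Set F} (hΩ : IsOpen Ω) (hK : IsCompact K)
    (hKΩ : K ⊆ Ω) {w G : F → ℝ} (hw : ContDiffOn ℝ 1 w Ω) (hG : ContDiffOn ℝ 1 G Ω)
    (hw0 : ∀ y ∈ Ω, y ∉ K → w y = 0) (μ : Measure F) [μ.IsAddHaarMeasure] (v : F) :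
    ∫ y in Ω, w y * fderiv ℝ G y v ∂μ = - ∫ y in Ω, fderiv ℝ w y v * G y ∂μ := by
  -- Extension by zero makes `w` globally `C¹` with compact support. `G` needs no extension: its
  -- differentiability is needed only on the support of `W`, inside `Ω`.
  set W : F → ℝ := Ω.indicator w with hW
  have hWin : ∀ y ∈ Ω, W =ᶠ[nhds y] w := fun y hy => by
    filter_upwards [hΩ.mem_nhds hy] with z hz using Set.indicator_of_mem hz w
  have hWout : ∀ y ∉ K, W y = 0 := fun y hy => by
    by_cases h : y ∈ Ω
    · rw [hW, Set.indicator_of_mem h, hw0 y h hy]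
    · exact Set.indicator_of_notMem h w
  have htsW : tsupport W ⊆ K :=
    closure_minimal (fun y hy => by_contra fun h => hy (hWout y h)) hK.isClosed
  have hWc : ContDiff ℝ 1 W := by
    refine contDiff_iff_contDiffAt.2 fun y => ?_
    by_cases hy : y ∈ Ω
    · exact (hw.contDiffAt (hΩ.mem_nhds hy)).congr_of_eventuallyEq (hWin y hy)
    · refine (contDiffAt_const (c := (0 : ℝ))).congr_of_eventuallyEq ?_
      filter_upwards [hK.isClosed.isOpen_compl.mem_nhds fun h => hy (hKΩ h)] with z hz
        using hWout z hz
  have hcs : HasCompactSupport W := HasCompactSupport.of_support_subset_isCompact hK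
    ((subset_tsupport W).trans htsW)
  have hdG : ContinuousOn (fun y => fderiv ℝ G y v) Ω :=
    (hG.continuousOn_fderiv_of_isOpen hΩ le_rfl).clm_apply continuousOn_const
  have hdW : Continuous fun y => fderiv ℝ W y v :=
    (hWc.continuous_fderiv one_ne_zero).clm_apply continuous_const
  have htsdW : tsupport (fun y => fderiv ℝ W y v) ⊆ K :=
    (tsupport_fderiv_apply_subset ℝ v).trans htsW
  have hcsd : HasCompactSupport (fun y => fderiv ℝ W y v) :=
    HasCompactSupport.of_support_subset_isCompact hK ((subset_tsupport _).trans htsdW)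
  -- `B` is uncontrolled outside `Ω`, but continuity of the product has to be checked only on the
  -- support of `A`.
  have hint : ∀ A B : F → ℝ, Continuous A → tsupport A ⊆ K → HasCompactSupport A →
      ContinuousOn B Ω → Integrable (fun y => A y * B y) μ := by
    intro A B hA hAK hAc hB
    refine Continuous.integrable_of_hasCompactSupport ?_ hAc.mul_right
    refine continuous_of_tsupport fun y hy => ?_
    have hyΩ : y ∈ Ω := hKΩ (hAK (tsupport_mul_subset_left hy))
    exact hA.continuousAt.mul (hB.continuousAt (hΩ.mem_nhds hyΩ))
  have main := integral_mul_fderiv_eq_neg_fderiv_mul_of_integrable (μ := μ) (f := W) (g := G)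
    (v := v) (hint _ _ hdW htsdW hcsd hG.continuousOn) (hint _ _ hWc.continuous htsW hcs hdG)
    (hint _ _ hWc.continuous htsW hcs hG.continuousOn)
    (fun y _ => hWc.differentiable one_ne_zero y)
    (fun y hy => (hG.contDiffAt (hΩ.mem_nhds (hKΩ (htsW hy)))).differentiableAt one_ne_zero)
  rw [← setIntegral_eq_integral_of_forall_compl_eq_zero (s := Ω) fun y hy => by
      rw [hWout y fun h => hy (hKΩ h), zero_mul],
    ← setIntegral_eq_integral_of_forall_compl_eq_zero (s := Ω)
      (f := fun y => fderiv ℝ W y v * G y) fun y hy => by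
        rw [image_eq_zero_of_notMem_tsupport fun h => hy (hKΩ (htsdW h)), zero_mul]] at main
  convert main using 1
  · exact setIntegral_congr_fun hΩ.measurableSet fun y hy => by
      simp only [(hWin y hy).eq_of_nhds]
  · congr 1
    exact setIntegral_congr_fun hΩ.measurableSet fun y hy => by
      simp only [(hWin y hy).fderiv_eq]

end Euclidean

/-! ### The divergence theorem. -/

section Divergence

variable {n : ℕ} {M : Type*} [TopologicalSpace M]
  [ChartedSpace (EuclideanSpace ℝ (Fin n)) M] [IsManifold (𝓡 n) ∞ M]

/-- The derivative of the function `w` along the vector field `X`. -/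
def along (X : ∀ x : M, TangentSpace (𝓡 n) x) (w : M → ℝ) (x : M) : ℝ :=
  mfderiv (𝓡 n) 𝓘(ℝ, ℝ) w x (X x)

/-- The divergence of `X`, computed in the chart at `c`. -/
def chartDivergence (g : Metric n M) (X : ∀ x : M, TangentSpace (𝓡 n) x) (c x : M) : ℝ :=
  (density g c (extChartAt (𝓡 n) c x))⁻¹ *
    ∑ i : Fin n,
      fderiv ℝ (fun y => density g c y * component X c i y) (extChartAt (𝓡 n) c x)
        (EuclideanSpace.single i (1 : ℝ))

/-- A vector field whose components in every chart are continuously differentiable. -/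
def IsC1Field (X : ∀ x : M, TangentSpace (𝓡 n) x) : Prop :=
  ∀ (c : M) (i : Fin n), ContDiffOn ℝ 1 (component X c i) (extChartAt (𝓡 n) c).target

variable {X : ∀ x : M, TangentSpace (𝓡 n) x}

theorem IsC1Field.contDiffOn_density_mul (g : Metric n M) (hX : IsC1Field X) (c : M) (i : Fin n) :
    ContDiffOn ℝ 1 (fun y => density g c y * component X c i y) (extChartAt (𝓡 n) c).target :=
  ((contDiffOn_density g c).of_le (by simp)).mul (hX c i)

theorem IsC1Field.continuousOn_chartDivergence (g : Metric n M) (hX : IsC1Field X) (c : M) :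
    ContinuousOn (chartDivergence g X c) (extChartAt (𝓡 n) c).source := by
  have h : ContinuousOn (fun y => (density g c y)⁻¹ * ∑ i : Fin n,
      fderiv ℝ (fun y => density g c y * component X c i y) y
        (EuclideanSpace.single i (1 : ℝ))) (extChartAt (𝓡 n) c).target :=
    ((contDiffOn_density g c).continuousOn.inv₀ fun y hy => (density_pos g hy).ne').mul
      (continuousOn_finsetSum _ fun i _ =>
        ((hX.contDiffOn_density_mul g c i).continuousOn_fderiv_of_isOpen (isOpen_target c)
          le_rfl).clm_apply continuousOn_const)
  exact h.comp (continuousOn_extChartAt c) (extChartAt (𝓡 n) c).mapsTo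

theorem along_extChartAt_symm {w : M → ℝ} (hw : ContMDiff (𝓡 n) 𝓘(ℝ, ℝ) 1 w) {c : M}
    {y : EuclideanSpace ℝ (Fin n)} (hy : y ∈ (extChartAt (𝓡 n) c).target) :
    along X w ((extChartAt (𝓡 n) c).symm y) =
      ∑ i, fderiv ℝ (fun z => w ((extChartAt (𝓡 n) c).symm z)) y
        (EuclideanSpace.single i (1 : ℝ)) * component X c i y :=
  mfderiv_apply_eq_sum hy (hw.mdifferentiable one_ne_zero _) X

theorem IsC1Field.continuous_along (hX : IsC1Field X) {w : M → ℝ}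
    (hw : ContMDiff (𝓡 n) 𝓘(ℝ, ℝ) 1 w) : Continuous (along X w) := by
  refine continuous_iff_continuousAt.2 fun c => ?_
  have h : ContinuousOn (fun y => ∑ i, fderiv ℝ (fun z => w ((extChartAt (𝓡 n) c).symm z)) y
        (EuclideanSpace.single i (1 : ℝ)) * component X c i y) (extChartAt (𝓡 n) c).target :=
    continuousOn_finsetSum _ fun i _ =>
      (((contDiffOn_comp_extChartAt_symm (by simp) hw c).continuousOn_fderiv_of_isOpen
        (isOpen_target c) le_rfl).clm_apply continuousOn_const).mul (hX c i).continuousOn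
  have h2 := h.comp (continuousOn_extChartAt c) (extChartAt (𝓡 n) c).mapsTo
  have h3 : ContinuousOn (along X w) (extChartAt (𝓡 n) c).source := h2.congr fun x hx => by
    simp only [Function.comp]
    rw [← along_extChartAt_symm hw ((extChartAt (𝓡 n) c).map_source hx),
      (extChartAt (𝓡 n) c).left_inv hx]
  exact h3.continuousAt ((isOpen_extChartAt_source c).mem_nhds (mem_extChartAt_source c))

theorem along_add {v w : M → ℝ} {x : M} (hv : MDifferentiableAt (𝓡 n) 𝓘(ℝ, ℝ) v x)
    (hw : MDifferentiableAt (𝓡 n) 𝓘(ℝ, ℝ) w x) :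
    along X (fun z => v z + w z) x = along X v x + along X w x := by
  have h := (hv.hasMFDerivAt.add hw.hasMFDerivAt).mfderiv
  exact DFunLike.congr_fun (F := EuclideanSpace ℝ (Fin n) →L[ℝ] ℝ) h (X x)

theorem along_mul {v w : M → ℝ} {x : M} (hv : MDifferentiableAt (𝓡 n) 𝓘(ℝ, ℝ) v x)
    (hw : MDifferentiableAt (𝓡 n) 𝓘(ℝ, ℝ) w x) :
    along X (fun z => v z * w z) x = v x * along X w x + w x * along X v x := by
  have h := (hv.hasMFDerivAt.mul hw.hasMFDerivAt).mfderiv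
  exact DFunLike.congr_fun (F := EuclideanSpace ℝ (Fin n) →L[ℝ] ℝ) h (X x)

theorem along_finsetSum {ι : Type*} (s : Finset ι) {F : ι → M → ℝ}
    (hF : ∀ i, MDifferentiable (𝓡 n) 𝓘(ℝ, ℝ) (F i)) (x : M) :
    along X (fun z => ∑ i ∈ s, F i z) x = ∑ i ∈ s, along X (F i) x := by
  classical
  suffices MDifferentiable (𝓡 n) 𝓘(ℝ, ℝ) (fun z => ∑ i ∈ s, F i z) ∧
      along X (fun z => ∑ i ∈ s, F i z) x = ∑ i ∈ s, along X (F i) x from this.2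
  induction s using Finset.induction_on with
  | empty =>
    refine ⟨by simpa using mdifferentiable_const, ?_⟩
    simp only [Finset.sum_empty, along, mfderiv_const]
    rfl
  | insert i s hi ih =>
    simp only [Finset.sum_insert hi]
    exact ⟨(hF i).add ih.1, by rw [along_add (hF i x) (ih.1 x), ih.2]⟩

theorem along_eq_zero_of_notMem_tsupport {w : M → ℝ} {x : M} (hx : x ∉ tsupport w) :
    along X w x = 0 := by
  have h : w =ᶠ[nhds x] fun _ => 0 := notMem_tsupport_iff_eventuallyEq.1 hx
  rw [along, h.mfderiv_eq, mfderiv_const]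
  rfl

variable [T2Space M] [CompactSpace M] [MeasurableSpace M] [BorelSpace M]

/-- The divergence theorem against a function supported in a chart domain. -/
theorem IsC1Field.integral_mul_chartDivergence (g : Metric n M) (hX : IsC1Field X) {c : M}
    {w : M → ℝ} (hw : ContMDiff (𝓡 n) 𝓘(ℝ, ℝ) 1 w)
    (hwc : tsupport w ⊆ (extChartAt (𝓡 n) c).source) :
    ∫ x, w x * chartDivergence g X c x ∂(riemannianVolume g) =
      - ∫ x, along X w x ∂(riemannianVolume g) := by
  have hT := (isOpen_target (n := n) c).measurableSet
  rw [integral_riemannianVolume_of_chart g c (h := fun x => w x * chartDivergence g X c x)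
      (hw.continuous.continuousOn.mul (hX.continuousOn_chartDivergence g c))
      (fun x hx => by rw [image_eq_zero_of_notMem_tsupport fun h => hx (hwc h), zero_mul]),
    integral_riemannianVolume_of_chart g c (hX.continuous_along hw).continuousOn
      (fun x hx => along_eq_zero_of_notMem_tsupport fun h => hx (hwc h))]
  set W : EuclideanSpace ℝ (Fin n) → ℝ := fun z => w ((extChartAt (𝓡 n) c).symm z) with hWdef
  set K : Set (EuclideanSpace ℝ (Fin n)) := extChartAt (𝓡 n) c '' tsupport w with hKdef
  have hK : IsCompact K :=
    (isClosed_tsupport w).isCompact.image_of_continuousOn ((continuousOn_extChartAt c).mono hwc)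
  have hKT : K ⊆ (extChartAt (𝓡 n) c).target := by
    rintro _ ⟨x, hx, rfl⟩
    exact (extChartAt (𝓡 n) c).map_source (hwc hx)
  have hW : ContDiffOn ℝ 1 W (extChartAt (𝓡 n) c).target :=
    contDiffOn_comp_extChartAt_symm (by simp) hw c
  have hW0 : ∀ y ∈ (extChartAt (𝓡 n) c).target, y ∉ K → W y = 0 := fun y hy hyK =>
    image_eq_zero_of_notMem_tsupport (f := w) fun h =>
      hyK ⟨_, h, (extChartAt (𝓡 n) c).right_inv hy⟩
  have hK0 : ∀ y ∈ (extChartAt (𝓡 n) c).target, y ∉ K → ∀ v, fderiv ℝ W y v = 0 := by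
    intro y hy hyK v
    have : W =ᶠ[nhds y] fun _ => 0 := by
      filter_upwards [(isOpen_target c).mem_nhds hy, hK.isClosed.isOpen_compl.mem_nhds hyK]
        with z hz hzK using hW0 z hz hzK
    rw [this.fderiv_eq]
    simp
  -- The coefficients may be unbounded near the edge of the chart, so integrability comes from
  -- vanishing off the compact set `K`.
  have hint : ∀ B : EuclideanSpace ℝ (Fin n) → ℝ,
      ContinuousOn B (extChartAt (𝓡 n) c).target →
      (∀ y ∈ (extChartAt (𝓡 n) c).target, y ∉ K → B y = 0) →
      IntegrableOn B (extChartAt (𝓡 n) c).target := by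
    intro B hB hB0
    have h1 : IntegrableOn B K := (hB.mono hKT).integrableOn_compact hK
    exact h1.of_forall_sdiff_eq_zero hT fun y hy => hB0 y hy.1 hy.2
  -- Integration by parts is applied to the density times a component; the inverse density in the
  -- divergence cancels against the volume element.
  have key : ∀ i, ∫ y in (extChartAt (𝓡 n) c).target, W y *
      fderiv ℝ (fun y => density g c y * component X c i y) y (EuclideanSpace.single i (1 : ℝ)) =
      - ∫ y in (extChartAt (𝓡 n) c).target, fderiv ℝ W y (EuclideanSpace.single i (1 : ℝ)) *
        (density g c y * component X c i y) := fun i =>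
    setIntegral_mul_fderiv_eq_neg (isOpen_target c) hK hKT hW (hX.contDiffOn_density_mul g c i)
      hW0 volume _
  calc ∫ y in (extChartAt (𝓡 n) c).target, density g c y * (w ((extChartAt (𝓡 n) c).symm y) *
        chartDivergence g X c ((extChartAt (𝓡 n) c).symm y))
      = ∫ y in (extChartAt (𝓡 n) c).target, ∑ i, W y *
          fderiv ℝ (fun y => density g c y * component X c i y) y
            (EuclideanSpace.single i (1 : ℝ)) := by
        refine setIntegral_congr_fun hT fun y hy => ?_
        simp only [chartDivergence]
        rw [(extChartAt (𝓡 n) c).right_inv hy, ← Finset.mul_sum]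
        have := (density_pos g hy).ne'
        field_simp
        exact mul_comm _ _
    _ = ∑ i, ∫ y in (extChartAt (𝓡 n) c).target, W y *
          fderiv ℝ (fun y => density g c y * component X c i y) y
            (EuclideanSpace.single i (1 : ℝ)) := by
        refine integral_finsetSum _ fun i _ => hint _ ?_ ?_
        · exact hW.continuousOn.mul (((hX.contDiffOn_density_mul g c i).continuousOn_fderiv_of_isOpen
            (isOpen_target c) le_rfl).clm_apply continuousOn_const)
        · exact fun y hy hyK => by rw [hW0 y hy hyK, zero_mul]
    _ = - ∑ i, ∫ y in (extChartAt (𝓡 n) c).target,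
          fderiv ℝ W y (EuclideanSpace.single i (1 : ℝ)) *
            (density g c y * component X c i y) := by
        rw [Finset.sum_congr rfl fun i _ => key i, Finset.sum_neg_distrib]
    _ = - ∫ y in (extChartAt (𝓡 n) c).target, ∑ i,
          fderiv ℝ W y (EuclideanSpace.single i (1 : ℝ)) *
            (density g c y * component X c i y) := by
        rw [integral_finsetSum]
        refine fun i _ => hint _ ?_ ?_
        · exact ((hW.continuousOn_fderiv_of_isOpen (isOpen_target c) le_rfl).clm_apply
            continuousOn_const).mul (hX.contDiffOn_density_mul g c i).continuousOn
        · exact fun y hy hyK => by rw [hK0 y hy hyK, zero_mul]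
    _ = - ∫ y in (extChartAt (𝓡 n) c).target, density g c y *
          along X w ((extChartAt (𝓡 n) c).symm y) := by
        congr 1
        refine setIntegral_congr_fun hT fun y hy => ?_
        rw [along_extChartAt_symm hw hy, Finset.mul_sum]
        exact Finset.sum_congr rfl fun i _ => by ring

theorem continuous_mul_of_tsupport_subset {Y : Type*} [TopologicalSpace Y] {U : Set Y}
    (hU : IsOpen U) {w h : Y → ℝ} (hw : Continuous w) (hwU : tsupport w ⊆ U)
    (hh : ContinuousOn h U) : Continuous fun x => w x * h x :=
  continuous_of_tsupport fun _ hx =>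
    hw.continuousAt.mul (hh.continuousAt (hU.mem_nhds (hwU (tsupport_mul_subset_left hx))))

/-- The divergence does not depend on the chart in which it is computed. -/
theorem IsC1Field.chartDivergence_eq (g : Metric n M) (hX : IsC1Field X) {c d x : M}
    (hc : x ∈ (extChartAt (𝓡 n) c).source) (hd : x ∈ (extChartAt (𝓡 n) d).source) :
    chartDivergence g X c x = chartDivergence g X d x := by
  set O : Set M := (extChartAt (𝓡 n) c).source ∩ (extChartAt (𝓡 n) d).source with hOdef
  have hO : IsOpen O := (isOpen_extChartAt_source c).inter (isOpen_extChartAt_source d)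
  set h : M → ℝ := fun z => chartDivergence g X c z - chartDivergence g X d z with hdef
  have hcO := (hX.continuousOn_chartDivergence g c).mono (Set.inter_subset_left : O ⊆ _)
  have hdO := (hX.continuousOn_chartDivergence g d).mono (Set.inter_subset_right : O ⊆ _)
  have hh : ContinuousOn h O := hcO.sub hdO
  -- Weak argument replacing a coordinate computation: against a test function `w` supported in the
  -- overlap, both divergences integrate to `-∫ X w`, which mentions no chart. Continuity and
  -- positivity of the volume on open sets then upgrade almost everywhere equality to equality at
  -- `x`.
  have hae : ∀ᵐ z ∂(riemannianVolume g), z ∈ O → h z = 0 := by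
    refine IsOpen.ae_eq_zero_of_integral_contMDiff_smul_eq_zero (𝓡 n) hO
      (hh.locallyIntegrableOn hO.measurableSet) fun w hw _ hwO => ?_
    have hw1 : ContMDiff (𝓡 n) 𝓘(ℝ, ℝ) 1 w := hw.of_le (by simp)
    have e : ∀ z, w z • h z = w z * chartDivergence g X c z - w z * chartDivergence g X d z :=
      fun z => by simp only [hdef, smul_eq_mul, mul_sub]
    simp only [e]
    rw [integral_sub, hX.integral_mul_chartDivergence g hw1 (hwO.trans Set.inter_subset_left),
      hX.integral_mul_chartDivergence g hw1 (hwO.trans Set.inter_subset_right), sub_self]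
    · exact integrable_riemannianVolume_of_continuous g
        (continuous_mul_of_tsupport_subset hO hw.continuous hwO hcO)
    · exact integrable_riemannianVolume_of_continuous g
        (continuous_mul_of_tsupport_subset hO hw.continuous hwO hdO)
  by_contra hne
  have hxO : x ∈ O := ⟨hc, hd⟩
  have hV : IsOpen (O ∩ h ⁻¹' {0}ᶜ) := hh.isOpen_inter_preimage hO isOpen_compl_singleton
  have h0 : riemannianVolume g (O ∩ h ⁻¹' {0}ᶜ) = 0 := by
    refine measure_mono_null (fun z hz => ?_) (ae_iff.1 hae)
    exact fun hz' => hz.2 (hz' hz.1)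
  exact (hV.measure_pos _ ⟨x, hxO, sub_ne_zero.2 hne⟩).ne' h0

theorem IsC1Field.divergence_eq (g : Metric n M) (hX : IsC1Field X) {c x : M}
    (hc : x ∈ (extChartAt (𝓡 n) c).source) : divergence g X x = chartDivergence g X c x :=
  hX.chartDivergence_eq g (mem_extChartAt_source x) hc

theorem IsC1Field.continuous_divergence (g : Metric n M) (hX : IsC1Field X) :
    Continuous (divergence g X) :=
  continuous_iff_continuousAt.2 fun c =>
    ((hX.continuousOn_chartDivergence g c).congr fun _ hx => hX.divergence_eq g hx).continuousAt
      ((isOpen_extChartAt_source c).mem_nhds (mem_extChartAt_source c))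

/-- The divergence theorem on a closed Riemannian manifold. -/
theorem IsC1Field.integral_mul_divergence (g : Metric n M) (hX : IsC1Field X)
    {w : M → ℝ} (hw : ContMDiff (𝓡 n) 𝓘(ℝ, ℝ) 1 w) :
    ∫ x, w x * divergence g X x ∂(riemannianVolume g) =
      - ∫ x, along X w x ∂(riemannianVolume g) := by
  have hρw : ∀ c : M, ContMDiff (𝓡 n) 𝓘(ℝ, ℝ) 1 fun x => chartPartition n M c x * w x :=
    fun c => ((contMDiff_chartPartition c).of_le (by simp)).mul hw
  have hts : ∀ c : M, tsupport (fun x => chartPartition n M c x * w x) ⊆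
      (extChartAt (𝓡 n) c).source :=
    fun c => tsupport_mul_subset_left.trans (tsupport_chartPartition_subset c)
  -- On the support of the weight the divergence may be computed in the single chart at `c`.
  have hloc : ∀ c : M, ∫ x, chartPartition n M c x * w x * divergence g X x ∂(riemannianVolume g)
      = - ∫ x, along X (fun x => chartPartition n M c x * w x) x ∂(riemannianVolume g) := by
    intro c
    rw [← hX.integral_mul_chartDivergence g (hρw c) (hts c)]
    refine integral_congr_ae (Filter.Eventually.of_forall fun x => ?_)
    simp only
    by_cases hx : x ∈ (extChartAt (𝓡 n) c).source
    · rw [hX.divergence_eq g hx]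
    · rw [chartPartition_eq_zero hx, zero_mul, zero_mul, zero_mul]
  have hw_sum : w = fun x => ∑ c ∈ chartIndex n M, chartPartition n M c x * w x := by
    funext x
    rw [← Finset.sum_mul, sum_chartPartition, one_mul]
  have halong : ∀ x, along X w x =
      ∑ c ∈ chartIndex n M, along X (fun x => chartPartition n M c x * w x) x := by
    intro x
    rw [← along_finsetSum _ fun c => (hρw c).mdifferentiable one_ne_zero, ← hw_sum]
  have hdiv : ∀ x, w x * divergence g X x =
      ∑ c ∈ chartIndex n M, chartPartition n M c x * w x * divergence g X x := by
    intro x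
    rw [← Finset.sum_mul]
    exact congrArg (· * _) (congrFun hw_sum x)
  simp only [hdiv, halong]
  rw [integral_finsetSum, integral_finsetSum, ← Finset.sum_neg_distrib]
  · exact Finset.sum_congr rfl fun c _ => hloc c
  · exact fun c _ => integrable_riemannianVolume_of_continuous g (hX.continuous_along (hρw c))
  · exact fun c _ => integrable_riemannianVolume_of_continuous g
      ((hρw c).continuous.mul (hX.continuous_divergence g))

end Divergence

/-! ### Differential inequalities for real functions of time. -/

section Frequency

variable {I D E φ : ℝ → ℝ} {a b : ℝ}

theorem hasDerivAt_of_mem_Ioo {F F' : ℝ → ℝ} {s t r : ℝ}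
    (hF : ∀ x ∈ Set.Icc a b, HasDerivWithinAt F (F' x) (Set.Icc a b) x)
    (hst : Set.Icc s t ⊆ Set.Icc a b) (hr : r ∈ Set.Ioo s t) : HasDerivAt F (F' r) r :=
  (hF r (hst (Set.Ioo_subset_Icc_self hr))).hasDerivAt
    (Filter.mem_of_superset (Icc_mem_nhds hr.1 hr.2) hst)

/-- In the quotient rule the `φ` terms cancel, leaving `2(IE - D²)/I²`. Positivity is asked only on
a subinterval because `energy_pos` uses the result before `I > 0` is known on all of `[a, b]`. -/
theorem frequency_monotoneOn_of_pos
    (hI : ∀ t ∈ Set.Icc a b, HasDerivWithinAt I (2 * D t + 2 * φ t * I t) (Set.Icc a b) t)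
    (hD : ∀ t ∈ Set.Icc a b, HasDerivWithinAt D (2 * E t + 2 * φ t * D t) (Set.Icc a b) t)
    (hCS : ∀ t ∈ Set.Icc a b, D t ^ 2 ≤ I t * E t)
    {s t : ℝ} (hst : Set.Icc s t ⊆ Set.Icc a b) (hpos : ∀ r ∈ Set.Icc s t, 0 < I r) :
    MonotoneOn (fun r => D r / I r) (Set.Icc s t) := by
  have hderiv : ∀ r ∈ Set.Ioo s t, HasDerivAt (fun r => D r / I r)
      (((2 * E r + 2 * φ r * D r) * I r - D r * (2 * D r + 2 * φ r * I r)) / I r ^ 2) r :=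
    fun r hr => (hasDerivAt_of_mem_Ioo hD hst hr).div (hasDerivAt_of_mem_Ioo hI hst hr)
      (hpos r (Set.Ioo_subset_Icc_self hr)).ne'
  refine monotoneOn_of_deriv_nonneg (convex_Icc s t) ?_ ?_ ?_
  · exact ContinuousOn.div (fun r hr => (hD r (hst hr)).continuousWithinAt.mono hst)
      (fun r hr => (hI r (hst hr)).continuousWithinAt.mono hst) fun r hr => (hpos r hr).ne'
  · rw [interior_Icc]
    exact fun r hr => (hderiv r hr).differentiableAt.differentiableWithinAt
  · rw [interior_Icc]
    intro r hr
    rw [(hderiv r hr).deriv]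
    have := hCS r (hst (Set.Ioo_subset_Icc_self hr))
    exact div_nonneg (by nlinarith) (sq_nonneg _)

theorem energy_pos
    (hI : ∀ t ∈ Set.Icc a b, HasDerivWithinAt I (2 * D t + 2 * φ t * I t) (Set.Icc a b) t)
    (hD : ∀ t ∈ Set.Icc a b, HasDerivWithinAt D (2 * E t + 2 * φ t * D t) (Set.Icc a b) t)
    (hφ : ContinuousOn φ (Set.Icc a b))
    (hI0 : ∀ t ∈ Set.Icc a b, 0 ≤ I t) (hD0 : ∀ t ∈ Set.Icc a b, D t ≤ 0)
    (hCS : ∀ t ∈ Set.Icc a b, D t ^ 2 ≤ I t * E t)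
    {s : ℝ} (hs : s ∈ Set.Icc a b) (hIs : 0 < I s) {t : ℝ} (ht : t ∈ Set.Icc a b) : 0 < I t := by
  obtain ⟨K, hK⟩ := isCompact_Icc.exists_bound_of_continuousOn hφ
  have hφK : ∀ r ∈ Set.Icc a b, φ r ≤ K ∧ -K ≤ φ r := fun r hr =>
    ⟨(abs_le.1 (hK r hr)).2, (abs_le.1 (hK r hr)).1⟩
  have hIc : ContinuousOn I (Set.Icc a b) := fun r hr => (hI r hr).continuousWithinAt
  have hexp : ∀ C : ℝ, ∀ {p q : ℝ}, Set.Icc p q ⊆ Set.Icc a b → ∀ r ∈ Set.Ioo p q,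
      HasDerivAt (fun r => I r * Real.exp (C * r))
        ((2 * D r + 2 * φ r * I r + C * I r) * Real.exp (C * r)) r := by
    intro C p q hpq r hr
    have h : HasDerivAt (fun r => Real.exp (C * r)) (Real.exp (C * r) * C) r := by
      simpa using ((hasDerivAt_id r).const_mul C).exp
    exact ((hasDerivAt_of_mem_Ioo hI hpq hr).mul h).congr_deriv (by ring)
  have hcont : ∀ C : ℝ, ContinuousOn (fun r => I r * Real.exp (C * r)) (Set.Icc a b) :=
    fun C => hIc.mul (by fun_prop)
  rcases le_total t s with hts | hst
  · have hsub : Set.Icc t s ⊆ Set.Icc a b := Set.Icc_subset_Icc ht.1 hs.2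
    -- Since `D ≤ 0` and `φ ≤ K`, one has `I' ≤ 2K I`: positivity at `s` propagates backwards.
    have hanti : AntitoneOn (fun r => I r * Real.exp (-(2 * K) * r)) (Set.Icc t s) := by
      refine antitoneOn_of_deriv_nonpos (convex_Icc t s) ((hcont _).mono hsub) ?_ ?_
      · rw [interior_Icc]
        exact fun r hr => (hexp _ hsub r hr).differentiableAt.differentiableWithinAt
      · rw [interior_Icc]
        intro r hr
        have hr' := hsub (Set.Ioo_subset_Icc_self hr)
        rw [(hexp _ hsub r hr).deriv]
        refine mul_nonpos_of_nonpos_of_nonneg ?_ (Real.exp_pos _).le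
        nlinarith [hφK r hr', hI0 r hr', hD0 r hr',
          mul_nonneg (hI0 r hr') (sub_nonneg.2 (hφK r hr').1)]
    have h := hanti (Set.left_mem_Icc.2 hts) (Set.right_mem_Icc.2 hts) hts
    simp only at h
    have h1 : 0 < I s * Real.exp (-(2 * K) * s) := mul_pos hIs (Real.exp_pos _)
    exact pos_of_mul_pos_left (h1.trans_le h) (Real.exp_pos _).le
  · by_contra hIt
    have hIt0 : I t = 0 := le_antisymm (not_lt.1 hIt) (hI0 t ht)
    have hsub : Set.Icc s t ⊆ Set.Icc a b := Set.Icc_subset_Icc hs.1 ht.2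
    -- Compactness of the zero set provides a first zero `z` after `s`, before which the quotient `D
    -- / I` is defined and monotone.
    have hZc : IsCompact (Set.Icc s t ∩ I ⁻¹' {0}) :=
      isCompact_Icc.of_isClosed_subset
        ((hIc.mono hsub).preimage_isClosed_of_isClosed isClosed_Icc isClosed_singleton)
        Set.inter_subset_left
    obtain ⟨z, ⟨hz, hz0⟩, hzmin⟩ := hZc.exists_isLeast ⟨t, Set.right_mem_Icc.2 hst, hIt0⟩
    have hsz : Set.Icc s z ⊆ Set.Icc a b :=
      (Set.Icc_subset_Icc le_rfl hz.2).trans hsub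
    have hpos : ∀ r ∈ Set.Ico s z, 0 < I r := by
      intro r hr
      have hr' : r ∈ Set.Icc s t := ⟨hr.1, hr.2.le.trans hz.2⟩
      refine lt_of_le_of_ne (hI0 r (hsub hr')) fun h => ?_
      exact absurd (hzmin ⟨hr', h.symm⟩) (not_le.2 hr.2)
    have hDr : ∀ r ∈ Set.Ioo s z, D s / I s * I r ≤ D r := by
      intro r hr
      have hmono := frequency_monotoneOn_of_pos hI hD hCS (s := s) (t := r)
        ((Set.Icc_subset_Icc le_rfl hr.2.le).trans hsz)
        fun q hq => hpos q ⟨hq.1, hq.2.trans_lt hr.2⟩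
      have := hmono (Set.left_mem_Icc.2 hr.1.le) (Set.right_mem_Icc.2 hr.1.le) hr.1.le
      exact (le_div_iff₀ (hpos r ⟨hr.1.le, hr.2⟩)).1 this
    -- From `D ≥ (D s / I s) I` and `φ ≥ -K` follows `I' ≥ -C I`, so `I exp(C r)` cannot decrease to
    -- zero at `z`.
    set C : ℝ := 2 * K - 2 * (D s / I s) with hC
    have hmono : MonotoneOn (fun r => I r * Real.exp (C * r)) (Set.Icc s z) := by
      refine monotoneOn_of_deriv_nonneg (convex_Icc s z) ((hcont _).mono hsz) ?_ ?_
      · rw [interior_Icc]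
        exact fun r hr => (hexp _ hsz r hr).differentiableAt.differentiableWithinAt
      · rw [interior_Icc]
        intro r hr
        have hr' := hsz (Set.Ioo_subset_Icc_self hr)
        rw [(hexp _ hsz r hr).deriv]
        refine mul_nonneg ?_ (Real.exp_pos _).le
        have h1 := hDr r hr
        have h2 := mul_nonneg (hI0 r hr') (neg_le_iff_add_nonneg.1 (hφK r hr').2)
        rw [hC]
        nlinarith
    have h := hmono (Set.left_mem_Icc.2 hz.1) (Set.right_mem_Icc.2 hz.1) hz.1
    have h1 : 0 < I s * Real.exp (C * s) := mul_pos hIs (Real.exp_pos _)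
    have h2 : I z = 0 := hz0
    simp only [h2, zero_mul] at h
    exact absurd h (not_le.2 h1)

/-- The logarithmic derivative of `I` is `2 D / I + 2φ`, a sum of two nondecreasing functions. -/
theorem log_energy_convexOn
    (hI : ∀ t ∈ Set.Icc a b, HasDerivWithinAt I (2 * D t + 2 * φ t * I t) (Set.Icc a b) t)
    (hpos : ∀ t ∈ Set.Icc a b, 0 < I t)
    (hU : MonotoneOn (fun t => D t / I t) (Set.Icc a b)) (hφ : MonotoneOn φ (Set.Icc a b)) :
    ConvexOn ℝ (Set.Icc a b) fun t => Real.log (I t) := by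
  have hderiv : ∀ r ∈ Set.Ioo a b, HasDerivAt (fun t => Real.log (I t))
      (2 * (D r / I r) + 2 * φ r) r := by
    intro r hr
    have h0 := (hpos r (Set.Ioo_subset_Icc_self hr)).ne'
    have h := (hasDerivAt_of_mem_Ioo hI subset_rfl hr).log h0
    convert h using 1
    field_simp
  refine MonotoneOn.convexOn_of_deriv (convex_Icc a b) ?_ ?_ ?_
  · exact ContinuousOn.log (fun r hr => (hI r hr).continuousWithinAt) fun r hr => (hpos r hr).ne'
  · rw [interior_Icc]
    exact fun r hr => (hderiv r hr).differentiableAt.differentiableWithinAt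
  · rw [interior_Icc]
    intro r hr q hq hrq
    rw [(hderiv r hr).deriv, (hderiv q hq).deriv]
    have h1 := hU (Set.Ioo_subset_Icc_self hr) (Set.Ioo_subset_Icc_self hq) hrq
    have h2 := hφ (Set.Ioo_subset_Icc_self hr) (Set.Ioo_subset_Icc_self hq) hrq
    simp only at h1
    linarith

/-- The numerator of the quotient rule must vanish. Derivatives within `[a, b]` are unique even at
the endpoints because `a < b`, so these need no separate limit. -/
theorem cauchySchwarz_eq_of_frequency_const (hab : a < b)
    (hI : ∀ t ∈ Set.Icc a b, HasDerivWithinAt I (2 * D t + 2 * φ t * I t) (Set.Icc a b) t)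
    (hD : ∀ t ∈ Set.Icc a b, HasDerivWithinAt D (2 * E t + 2 * φ t * D t) (Set.Icc a b) t)
    (hpos : ∀ t ∈ Set.Icc a b, 0 < I t)
    (hconst : ∀ s ∈ Set.Icc a b, ∀ t ∈ Set.Icc a b, D s / I s = D t / I t)
    {t : ℝ} (ht : t ∈ Set.Icc a b) : D t ^ 2 = I t * E t := by
  have h1 := (hD t ht).div (hI t ht) (hpos t ht).ne'
  have h2 : HasDerivWithinAt (fun r => D r / I r) 0 (Set.Icc a b) t :=
    (hasDerivWithinAt_const t (Set.Icc a b) (D t / I t)).congr (fun r hr => hconst r hr t ht) rfl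
  have h3 := (uniqueDiffOn_Icc hab t ht).eq_deriv _ h1 h2
  rw [div_eq_zero_iff, or_iff_left (pow_ne_zero 2 (hpos t ht).ne')] at h3
  linarith

end Frequency

/-! ### Differentiating a symmetric pairing in time. -/

section DerivativeOfPairing

variable {M V : Type*} [TopologicalSpace M] [CompactSpace M] [MeasurableSpace M] [BorelSpace M]
  [NormedAddCommGroup V] [InnerProductSpace ℝ V] [SecondCountableTopology V]

/-- A function `J` of time whose increments are given by a symmetric pairing is differentiable. -/
theorem hasDerivWithinAt_of_sub_eq_integral_inner (μ : Measure M) [IsFiniteMeasure μ]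
    {a b : ℝ} {u u' Φ : M → ℝ → V} {J : ℝ → ℝ}
    (hu : ContinuousOn (fun p : M × ℝ => u p.1 p.2) (Set.univ ×ˢ Set.Icc a b))
    (hu' : ContinuousOn (fun p : M × ℝ => u' p.1 p.2) (Set.univ ×ˢ Set.Icc a b))
    (hΦ : ContinuousOn (fun p : M × ℝ => Φ p.1 p.2) (Set.univ ×ˢ Set.Icc a b))
    (hderiv : ∀ x, ∀ t ∈ Set.Icc a b, HasDerivWithinAt (u x) (u' x t) (Set.Icc a b) t)
    (hJ : ∀ s ∈ Set.Icc a b, ∀ t ∈ Set.Icc a b,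
      J t - J s = ∫ x, inner ℝ (u x t - u x s) (Φ x t + Φ x s) ∂μ)
    {s : ℝ} (hs : s ∈ Set.Icc a b) :
    HasDerivWithinAt J (2 * ∫ x, inner ℝ (u' x s) (Φ x s) ∂μ) (Set.Icc a b) s := by
  have hcpt : IsCompact ((Set.univ : Set M) ×ˢ Set.Icc a b) := isCompact_univ.prod isCompact_Icc
  obtain ⟨A, hA⟩ := hcpt.exists_bound_of_continuousOn hu'
  obtain ⟨B, hB⟩ := hcpt.exists_bound_of_continuousOn hΦ
  have hslice : ∀ {F : M → ℝ → V},
      ContinuousOn (fun p : M × ℝ => F p.1 p.2) (Set.univ ×ˢ Set.Icc a b) →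
      ∀ t ∈ Set.Icc a b, Continuous fun x => F x t := fun hF t ht =>
    continuousOn_univ.1 <| hF.comp (f := fun x : M => (x, t)) (by fun_prop)
      fun x _ => ⟨Set.mem_univ x, ht⟩
  -- The mean value inequality bounds the difference quotients uniformly in `x`, which gives a
  -- constant dominating function on a finite measure space.
  have hslope : ∀ x, ∀ t ∈ Set.Icc a b, ‖slope (u x) s t‖ ≤ A := by
    intro x t ht
    rcases eq_or_ne t s with rfl | hne
    · rw [slope_same, norm_zero]
      exact (norm_nonneg _).trans (hA (x, t) ⟨Set.mem_univ x, ht⟩)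
    · have h := (convex_Icc a b).norm_image_sub_le_of_norm_hasDerivWithin_le
        (fun r hr => hderiv x r hr) (fun r hr => hA (x, r) ⟨Set.mem_univ x, hr⟩) hs ht
      rw [slope_def_module, norm_smul, norm_inv]
      exact (inv_mul_le_iff₀ (norm_pos_iff.2 (sub_ne_zero.2 hne))).2 (by linarith)
  rw [hasDerivWithinAt_iff_tendsto_slope]
  -- Only `u` is differentiated; continuity of `Φ` makes the second factor tend to `2Φ(s)`.
  have hlim : Filter.Tendsto (fun t => ∫ x, inner ℝ (slope (u x) s t) (Φ x t + Φ x s) ∂μ)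
      (nhdsWithin s (Set.Icc a b \ {s})) (nhds (∫ x, inner ℝ (u' x s) (Φ x s + Φ x s) ∂μ)) := by
    have hmem : ∀ᶠ t in nhdsWithin s (Set.Icc a b \ {s}), t ∈ Set.Icc a b :=
      Filter.mem_of_superset self_mem_nhdsWithin Set.sdiff_subset
    refine tendsto_integral_filter_of_dominated_convergence (fun _ => A * (B + B)) ?_ ?_ ?_ ?_
    · filter_upwards [hmem] with t ht
      refine Continuous.aestronglyMeasurable ?_
      simp only [slope_def_module]
      exact (((hslice hu t ht).sub (hslice hu s hs)).const_smul _).inner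
        ((hslice hΦ t ht).add (hslice hΦ s hs))
    · filter_upwards [hmem] with t ht
      refine Filter.Eventually.of_forall fun x => (norm_inner_le_norm _ _).trans ?_
      refine mul_le_mul (hslope x t ht) ((norm_add_le _ _).trans (add_le_add
        (hB (x, t) ⟨Set.mem_univ x, ht⟩) (hB (x, s) ⟨Set.mem_univ x, hs⟩))) (norm_nonneg _)
        ((norm_nonneg _).trans (hslope x t ht))
    · exact integrable_const _
    · refine Filter.Eventually.of_forall fun x => ?_
      have h1 := hasDerivWithinAt_iff_tendsto_slope.1 (hderiv x s hs)
      have h2 : ContinuousWithinAt (fun t => Φ x t) (Set.Icc a b) s :=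
        (hΦ.comp (f := fun t : ℝ => (x, t)) (by fun_prop) fun t ht => ⟨Set.mem_univ x, ht⟩) s hs
      exact h1.inner ((h2.mono Set.sdiff_subset).tendsto.add_const _)
  have hval : ∫ x, inner ℝ (u' x s) (Φ x s + Φ x s) ∂μ =
      2 * ∫ x, inner ℝ (u' x s) (Φ x s) ∂μ := by
    rw [← integral_const_mul]
    congr 1
    funext x
    rw [inner_add_right]
    ring
  rw [hval] at hlim
  refine hlim.congr' ?_
  filter_upwards [self_mem_nhdsWithin] with t ht
  rw [slope_def_module, hJ s hs t ht.1, smul_eq_mul, ← integral_const_mul]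
  congr 1
  funext x
  rw [slope_def_module, real_inner_smul_left]

end DerivativeOfPairing

/-! ### Green's formula and self-adjointness for the weighted measure. -/

section Green

variable {n : ℕ} {M : Type*} [TopologicalSpace M]
  [ChartedSpace (EuclideanSpace ℝ (Fin n)) M] [IsManifold (𝓡 n) ∞ M]
  [T2Space M] [CompactSpace M] [MeasurableSpace M] [BorelSpace M]
  {g : Metric n M} {f : M → ℝ}
  {T : ∀ x : M, TangentSpace (𝓡 n) x →L[ℝ] TangentSpace (𝓡 n) x}

theorem isFiniteMeasure_weightedVolume (g : Metric n M) (hf : Continuous f) :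
    IsFiniteMeasure (weightedVolume g f) := by
  have h : Integrable (fun x => Real.exp (-f x)) (riemannianVolume g) :=
    integrable_riemannianVolume_of_continuous g (by fun_prop)
  exact isFiniteMeasure_withDensity_ofReal h.2

theorem isOpenPosMeasure_weightedVolume (g : Metric n M) (hf : Continuous f) :
    (weightedVolume g f).IsOpenPosMeasure := by
  have hac : riemannianVolume g ≪ weightedVolume g f := by
    refine withDensity_absolutelyContinuous' ?_ ?_
    · exact (by fun_prop : Continuous fun x => Real.exp (-f x)).measurable.ennreal_ofReal.aemeasurable
    · exact Filter.Eventually.of_forall fun x => (ENNReal.ofReal_pos.2 (Real.exp_pos _)).ne'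
  exact hac.isOpenPosMeasure

theorem integral_weightedVolume (g : Metric n M) (hf : Continuous f) (h : M → ℝ) :
    ∫ x, h x ∂(weightedVolume g f) = ∫ x, Real.exp (-f x) * h x ∂(riemannianVolume g) := by
  rw [weightedVolume, integral_withDensity_eq_integral_toReal_smul₀]
  · simp only [ENNReal.toReal_ofReal (Real.exp_pos _).le, smul_eq_mul]
  · exact (by fun_prop : Continuous fun x => Real.exp (-f x)).measurable.ennreal_ofReal.aemeasurable
  · exact Filter.Eventually.of_forall fun _ => ENNReal.ofReal_lt_top

theorem isC1Field_tensor_grad (hT : IsSymmPosDefTensor g T) {w : M → ℝ}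
    (hw : ContMDiff (𝓡 n) 𝓘(ℝ, ℝ) ∞ w) : IsC1Field fun x => T x (grad g w x) :=
  fun c i => (contDiffOn_component_tensor_grad hT hw c i).of_le (by simp)

theorem along_tensor_grad (v w : M → ℝ) (x : M) :
    along (fun x => T x (grad g w x)) v x = g.inner x (T x (grad g w x)) (grad g v x) := by
  rw [along, ← inner_grad g, g.symm]

theorem diffusion_eq (w : M → ℝ) (x : M) :
    diffusion g f T w x = divergence g (fun y => T y (grad g w y)) x
      - along (fun x => T x (grad g w x)) f x := by
  rw [diffusion, inner_grad]
  rfl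

theorem continuous_diffusion (hf : ContMDiff (𝓡 n) 𝓘(ℝ, ℝ) 1 f) (hT : IsSymmPosDefTensor g T)
    {w : M → ℝ} (hw : ContMDiff (𝓡 n) 𝓘(ℝ, ℝ) ∞ w) : Continuous (diffusion g f T w) := by
  simp only [funext (diffusion_eq (g := g) (f := f) (T := T) w)]
  exact ((isC1Field_tensor_grad hT hw).continuous_divergence g).sub
    ((isC1Field_tensor_grad hT hw).continuous_along hf)

/-- Green's formula for the weighted operator `𝓛`. -/
theorem integral_mul_diffusion (hf : ContMDiff (𝓡 n) 𝓘(ℝ, ℝ) 1 f) (hT : IsSymmPosDefTensor g T)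
    {v w : M → ℝ} (hv : ContMDiff (𝓡 n) 𝓘(ℝ, ℝ) ∞ v) (hw : ContMDiff (𝓡 n) 𝓘(ℝ, ℝ) ∞ w) :
    ∫ x, v x * diffusion g f T w x ∂(weightedVolume g f) =
      - ∫ x, g.inner x (T x (grad g w x)) (grad g v x) ∂(weightedVolume g f) := by
  have hX := isC1Field_tensor_grad hT hw
  set X : ∀ x : M, TangentSpace (𝓡 n) x := fun x => T x (grad g w x) with hXdef
  have hv1 : ContMDiff (𝓡 n) 𝓘(ℝ, ℝ) 1 v := hv.of_le (by simp)
  have he : ContMDiff (𝓡 n) 𝓘(ℝ, ℝ) 1 fun x => Real.exp (-f x) :=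
    (Real.contDiff_exp.comp contDiff_neg).contMDiff.comp hf
  have hexp : ∀ x, along X (fun x => Real.exp (-f x)) x = -(Real.exp (-f x) * along X f x) := by
    intro x
    have h1 : HasDerivAt (fun r : ℝ => Real.exp (-r)) (-Real.exp (-f x)) (f x) := by
      simpa using (hasDerivAt_neg (f x)).exp
    have h2 := h1.hasFDerivAt.hasMFDerivAt.comp x (hf.mdifferentiable one_ne_zero x).hasMFDerivAt
    have h3 := DFunLike.congr_fun (F := EuclideanSpace ℝ (Fin n) →L[ℝ] ℝ) h2.mfderiv (X x)
    refine h3.trans ?_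
    change along X f x • (-Real.exp (-f x)) = _
    rw [smul_eq_mul]
    ring
  -- The divergence theorem is applied to `exp(-f) v`; the derivative falling on the weight
  -- reproduces the drift term of the operator.
  have hprod : ∀ x, along X (fun x => Real.exp (-f x) * v x) x =
      Real.exp (-f x) * along X v x - Real.exp (-f x) * v x * along X f x := by
    intro x
    rw [along_mul (he.mdifferentiable one_ne_zero x) (hv1.mdifferentiable one_ne_zero x), hexp]
    ring
  have hev : ContMDiff (𝓡 n) 𝓘(ℝ, ℝ) 1 fun x => Real.exp (-f x) * v x := he.mul hv1
  have h := hX.integral_mul_divergence g hev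
  rw [integral_weightedVolume g hf.continuous, integral_weightedVolume g hf.continuous]
  have e1 : ∀ x, Real.exp (-f x) * (v x * diffusion g f T w x) =
      Real.exp (-f x) * v x * divergence g X x - Real.exp (-f x) * v x * along X f x := by
    intro x
    rw [diffusion_eq]
    ring
  have e2 : ∀ x, Real.exp (-f x) * g.inner x (T x (grad g w x)) (grad g v x) =
      along X (fun x => Real.exp (-f x) * v x) x + Real.exp (-f x) * v x * along X f x := by
    intro x
    rw [← along_tensor_grad, hprod]
    ring
  simp only [e1, e2]
  have hc : Continuous fun x => Real.exp (-f x) * v x := hev.continuous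
  rw [integral_sub, integral_add, h]
  · ring
  · exact integrable_riemannianVolume_of_continuous g (hX.continuous_along hev)
  · exact integrable_riemannianVolume_of_continuous g (hc.mul (hX.continuous_along hf))
  · exact integrable_riemannianVolume_of_continuous g (hc.mul (hX.continuous_divergence g))
  · exact integrable_riemannianVolume_of_continuous g (hc.mul (hX.continuous_along hf))

theorem integral_diffusion_comm (hf : ContMDiff (𝓡 n) 𝓘(ℝ, ℝ) 1 f) (hT : IsSymmPosDefTensor g T)
    {v w : M → ℝ} (hv : ContMDiff (𝓡 n) 𝓘(ℝ, ℝ) ∞ v) (hw : ContMDiff (𝓡 n) 𝓘(ℝ, ℝ) ∞ w) :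
    ∫ x, v x * diffusion g f T w x ∂(weightedVolume g f) =
      ∫ x, w x * diffusion g f T v x ∂(weightedVolume g f) := by
  rw [integral_mul_diffusion hf hT hv hw, integral_mul_diffusion hf hT hw hv]
  congr 2
  funext x
  rw [hT.symm, g.symm]

variable {m : ℕ} {v w : M → EuclideanSpace ℝ (Fin m)}

theorem integrable_weightedVolume_of_continuous {F : Type*} [NormedAddCommGroup F]
    (g : Metric n M) (hf : Continuous f) {h : M → F} (hh : Continuous h) :
    Integrable h (weightedVolume g f) :=
  have := isFiniteMeasure_weightedVolume g hf
  hh.integrable_of_hasCompactSupport (HasCompactSupport.of_compactSpace h)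

theorem contMDiff_coordinate {k : WithTop ℕ∞}
    (hv : ContMDiff (𝓡 n) 𝓘(ℝ, EuclideanSpace ℝ (Fin m)) k v) (j : Fin m) :
    ContMDiff (𝓡 n) 𝓘(ℝ, ℝ) k fun x => v x j :=
  (EuclideanSpace.proj (𝕜 := ℝ) j).contDiff.contMDiff.comp hv

theorem inner_diffusionVec (x : M) : inner ℝ (v x) (diffusionVec g f T w x) =
    ∑ j, v x j * diffusion g f T (fun y => w y j) x := by
  simp [PiLp.inner_apply, diffusionVec, mul_comm]

theorem integral_inner_diffusionVec (hf : ContMDiff (𝓡 n) 𝓘(ℝ, ℝ) 1 f)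
    (hT : IsSymmPosDefTensor g T)
    (hv : ContMDiff (𝓡 n) 𝓘(ℝ, EuclideanSpace ℝ (Fin m)) ∞ v)
    (hw : ContMDiff (𝓡 n) 𝓘(ℝ, EuclideanSpace ℝ (Fin m)) ∞ w) :
    ∫ x, inner ℝ (v x) (diffusionVec g f T w x) ∂(weightedVolume g f) =
      ∑ j, ∫ x, v x j * diffusion g f T (fun y => w y j) x ∂(weightedVolume g f) := by
  simp only [inner_diffusionVec]
  exact integral_finsetSum _ fun j _ => integrable_weightedVolume_of_continuous g hf.continuous
    ((contMDiff_coordinate hv j).continuous.mul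
      (continuous_diffusion hf hT (contMDiff_coordinate hw j)))

theorem integral_inner_diffusionVec_comm (hf : ContMDiff (𝓡 n) 𝓘(ℝ, ℝ) 1 f)
    (hT : IsSymmPosDefTensor g T)
    (hv : ContMDiff (𝓡 n) 𝓘(ℝ, EuclideanSpace ℝ (Fin m)) ∞ v)
    (hw : ContMDiff (𝓡 n) 𝓘(ℝ, EuclideanSpace ℝ (Fin m)) ∞ w) :
    ∫ x, inner ℝ (v x) (diffusionVec g f T w x) ∂(weightedVolume g f) =
      ∫ x, inner ℝ (w x) (diffusionVec g f T v x) ∂(weightedVolume g f) := by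
  rw [integral_inner_diffusionVec hf hT hv hw, integral_inner_diffusionVec hf hT hw hv]
  exact Finset.sum_congr rfl fun j _ =>
    integral_diffusion_comm hf hT (contMDiff_coordinate hv j) (contMDiff_coordinate hw j)

theorem continuous_tensor_grad_grad (hT : IsSymmPosDefTensor g T) {v w : M → ℝ}
    (hv : ContMDiff (𝓡 n) 𝓘(ℝ, ℝ) ∞ v) (hw : ContMDiff (𝓡 n) 𝓘(ℝ, ℝ) ∞ w) :
    Continuous fun x => g.inner x (T x (grad g w x)) (grad g v x) := by
  simp only [← along_tensor_grad]
  exact (isC1Field_tensor_grad hT hw).continuous_along (hv.of_le (by simp))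

/-- As a pairing of `u` with its image under the operator, `D` becomes accessible both to
Cauchy–Schwarz and to differentiation in time. -/
theorem energyD_eq_integral_inner (hf : ContMDiff (𝓡 n) 𝓘(ℝ, ℝ) 1 f)
    (hT : IsSymmPosDefTensor g T) {u : M → ℝ → EuclideanSpace ℝ (Fin m)} {t : ℝ}
    (hu : ContMDiff (𝓡 n) 𝓘(ℝ, EuclideanSpace ℝ (Fin m)) ∞ fun x => u x t) :
    energyD g f T u t = ∫ x, inner ℝ (u x t) (diffusionVec g f T (fun y => u y t) x)
      ∂(weightedVolume g f) := by
  have huj := contMDiff_coordinate hu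
  rw [integral_inner_diffusionVec hf hT hu hu, energyD, integral_finsetSum,
    ← Finset.sum_neg_distrib]
  · exact Finset.sum_congr rfl fun j _ => (integral_mul_diffusion hf hT (huj j) (huj j)).symm
  · exact fun j _ => integrable_weightedVolume_of_continuous g hf.continuous
      (continuous_tensor_grad_grad hT (huj j) (huj j))

theorem energyD_nonpos (hT : IsSymmPosDefTensor g T) (u : M → ℝ → EuclideanSpace ℝ (Fin m))
    (t : ℝ) : energyD g f T u t ≤ 0 := by
  refine neg_nonpos.2 (integral_nonneg fun x => Finset.sum_nonneg fun j _ => ?_)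
  by_cases h : grad g (fun y => u y t j) x = 0
  · simp [h]
  · exact (hT.pos x _ h).le

end Green

/-! ### Joint regularity in space and time, up to the end times. -/

section TimeDerivative

variable {n : ℕ} {M : Type*} [TopologicalSpace M]
  [ChartedSpace (EuclideanSpace ℝ (Fin n)) M] [IsManifold (𝓡 n) ∞ M]
  {V : Type*} [NormedAddCommGroup V] [NormedSpace ℝ V] {a b : ℝ} {u : M → ℝ → V}

theorem contDiffOn_chart_prod
    (hu : ContMDiffOn ((𝓡 n).prod 𝓘(ℝ, ℝ)) 𝓘(ℝ, V) ∞ (fun p : M × ℝ => u p.1 p.2)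
      (Set.univ ×ˢ Set.Icc a b)) (c : M) :
    ContDiffOn ℝ ∞ (fun q : EuclideanSpace ℝ (Fin n) × ℝ => u ((extChartAt (𝓡 n) c).symm q.1) q.2)
      ((extChartAt (𝓡 n) c).target ×ˢ Set.Icc a b) := by
  have h1 : ContMDiffOn 𝓘(ℝ, EuclideanSpace ℝ (Fin n) × ℝ) ((𝓡 n).prod 𝓘(ℝ, ℝ)) ∞
      (fun q : EuclideanSpace ℝ (Fin n) × ℝ => ((extChartAt (𝓡 n) c).symm q.1, q.2))
      ((extChartAt (𝓡 n) c).target ×ˢ Set.Icc a b) :=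
    ContMDiffOn.prodMk
      ((contMDiffOn_extChartAt_symm c).comp contDiff_fst.contMDiff.contMDiffOn fun q hq => hq.1)
      contDiff_snd.contMDiff.contMDiffOn
  exact contMDiffOn_iff_contDiffOn.1 (hu.comp h1 fun q hq => ⟨Set.mem_univ _, hq.2⟩)

theorem hasDerivWithinAt_chart_prod
    (hu : ContMDiffOn ((𝓡 n).prod 𝓘(ℝ, ℝ)) 𝓘(ℝ, V) ∞ (fun p : M × ℝ => u p.1 p.2)
      (Set.univ ×ˢ Set.Icc a b)) {c x : M} (hx : x ∈ (extChartAt (𝓡 n) c).source)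
    {t : ℝ} (ht : t ∈ Set.Icc a b) :
    HasDerivWithinAt (u x) (fderivWithin ℝ
      (fun q : EuclideanSpace ℝ (Fin n) × ℝ => u ((extChartAt (𝓡 n) c).symm q.1) q.2)
      ((extChartAt (𝓡 n) c).target ×ˢ Set.Icc a b) (extChartAt (𝓡 n) c x, t) (0, 1))
      (Set.Icc a b) t := by
  have hxt := (extChartAt (𝓡 n) c).map_source hx
  have h1 := ((contDiffOn_chart_prod hu c).differentiableOn (by simp)
    (extChartAt (𝓡 n) c x, t) ⟨hxt, ht⟩).hasFDerivWithinAt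
  have h2 : HasDerivWithinAt (fun s : ℝ => (extChartAt (𝓡 n) c x, s)) (0, 1) (Set.Icc a b) t :=
    (hasDerivWithinAt_const t _ _).prodMk (hasDerivWithinAt_id t _)
  have h3 := h1.comp_hasDerivWithinAt t h2 fun s hs => ⟨hxt, hs⟩
  convert h3 using 1
  funext s
  simp only [Function.comp]
  rw [(extChartAt (𝓡 n) c).left_inv hx]

theorem hasDerivWithinAt_of_contMDiffOn
    (hu : ContMDiffOn ((𝓡 n).prod 𝓘(ℝ, ℝ)) 𝓘(ℝ, V) ∞ (fun p : M × ℝ => u p.1 p.2)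
      (Set.univ ×ˢ Set.Icc a b)) (x : M) {t : ℝ} (ht : t ∈ Set.Icc a b) :
    HasDerivWithinAt (u x) (derivWithin (u x) (Set.Icc a b) t) (Set.Icc a b) t :=
  (hasDerivWithinAt_chart_prod hu
    (mem_extChartAt_source x) ht).differentiableWithinAt.hasDerivWithinAt

/-- In a chart the time derivative is the full derivative within target × `[a, b]` in the direction
`(0, 1)`, and the latter is continuous because this product is a set of unique differentiability. -/
theorem continuousOn_derivWithin_time (hab : a < b)
    (hu : ContMDiffOn ((𝓡 n).prod 𝓘(ℝ, ℝ)) 𝓘(ℝ, V) ∞ (fun p : M × ℝ => u p.1 p.2)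
      (Set.univ ×ˢ Set.Icc a b)) :
    ContinuousOn (fun p : M × ℝ => derivWithin (u p.1) (Set.Icc a b) p.2)
      (Set.univ ×ˢ Set.Icc a b) := by
  rintro ⟨c, t⟩ ⟨-, ht⟩
  set O := (extChartAt (𝓡 n) c).source with hO
  have hS : UniqueDiffOn ℝ ((extChartAt (𝓡 n) c).target ×ˢ Set.Icc a b) :=
    (isOpen_target c).uniqueDiffOn.prod (uniqueDiffOn_Icc hab)
  have h1 : ContinuousOn (fun q : EuclideanSpace ℝ (Fin n) × ℝ => fderivWithin ℝ
      (fun q : EuclideanSpace ℝ (Fin n) × ℝ => u ((extChartAt (𝓡 n) c).symm q.1) q.2)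
      ((extChartAt (𝓡 n) c).target ×ˢ Set.Icc a b) q (0, 1))
      ((extChartAt (𝓡 n) c).target ×ˢ Set.Icc a b) :=
    ((contDiffOn_chart_prod hu c).continuousOn_fderivWithin hS (by simp)).clm_apply
      continuousOn_const
  have h2 : ContinuousOn (fun p : M × ℝ => (extChartAt (𝓡 n) c p.1, p.2)) (O ×ˢ Set.Icc a b) :=
    ((continuousOn_extChartAt c).comp continuousOn_fst fun p hp => hp.1).prodMk continuousOn_snd
  have h3 := h1.comp h2 fun p hp => ⟨(extChartAt (𝓡 n) c).map_source hp.1, hp.2⟩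
  have h4 : ContinuousOn (fun p : M × ℝ => derivWithin (u p.1) (Set.Icc a b) p.2)
      (O ×ˢ Set.Icc a b) := h3.congr fun p hp =>
    (hasDerivWithinAt_chart_prod hu hp.1 hp.2).derivWithin (uniqueDiffOn_Icc hab p.2 hp.2)
  refine (h4 (c, t) ⟨mem_extChartAt_source c, ht⟩).mono_of_mem_nhdsWithin ?_
  have : O ×ˢ Set.univ ∈ nhds (c, t) :=
    prod_mem_nhds (extChartAt_source_mem_nhds c) Filter.univ_mem
  filter_upwards [self_mem_nhdsWithin, mem_nhdsWithin_of_mem_nhds this] with p hp hp'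
  exact ⟨hp'.1, hp.2⟩

theorem contMDiff_slice
    (hu : ContMDiffOn ((𝓡 n).prod 𝓘(ℝ, ℝ)) 𝓘(ℝ, V) ∞ (fun p : M × ℝ => u p.1 p.2)
      (Set.univ ×ˢ Set.Icc a b)) {t : ℝ} (ht : t ∈ Set.Icc a b) :
    ContMDiff (𝓡 n) 𝓘(ℝ, V) ∞ fun x => u x t :=
  contMDiffOn_univ.1 <| hu.comp (f := fun x : M => (x, t))
    (contMDiff_id.prodMk contMDiff_const).contMDiffOn fun x _ => ⟨Set.mem_univ x, ht⟩

end TimeDerivative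

/-! ### Consequences of the evolution equation. -/

section HeatSolution

variable {n m : ℕ} {M : Type*} [TopologicalSpace M]
  [ChartedSpace (EuclideanSpace ℝ (Fin n)) M] [IsManifold (𝓡 n) ∞ M]
  {g : Metric n M} {f : M → ℝ}
  {T : ∀ x : M, TangentSpace (𝓡 n) x →L[ℝ] TangentSpace (𝓡 n) x} {a b : ℝ} {φ : ℝ → ℝ}
  {u : M → ℝ → EuclideanSpace ℝ (Fin m)}

theorem IsHeatSolution.diffusionVec_eq (hu : IsHeatSolution g f T φ a b u) (x : M) {t : ℝ}
    (ht : t ∈ Set.Icc a b) : diffusionVec g f T (fun y => u y t) x =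
      derivWithin (u x) (Set.Icc a b) t - φ t • u x t := by
  rw [← hu.equation x t ht]
  abel

theorem IsHeatSolution.hasDerivWithinAt (hu : IsHeatSolution g f T φ a b u) (x : M)
    {t : ℝ} (ht : t ∈ Set.Icc a b) :
    HasDerivWithinAt (u x) (diffusionVec g f T (fun y => u y t) x + φ t • u x t)
      (Set.Icc a b) t := by
  rw [hu.diffusionVec_eq x ht, sub_add_cancel]
  exact hasDerivWithinAt_of_contMDiffOn hu.smooth x ht

/-- The equation expresses the operator as `u_t - φu`, so joint continuity requires no study of
space derivatives depending on time. -/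
theorem IsHeatSolution.continuousOn_diffusionVec (hu : IsHeatSolution g f T φ a b u) (hab : a < b)
    (hφ : ContinuousOn φ (Set.Icc a b)) :
    ContinuousOn (fun p : M × ℝ => diffusionVec g f T (fun y => u y p.2) p.1)
      (Set.univ ×ˢ Set.Icc a b) :=
  ((continuousOn_derivWithin_time hab hu.smooth).sub
    ((hφ.comp continuousOn_snd fun _ hp => hp.2).smul hu.smooth.continuousOn)).congr
      fun p hp => hu.diffusionVec_eq p.1 hp.2

theorem IsHeatSolution.continuous_diffusionVec (hu : IsHeatSolution g f T φ a b u) (hab : a < b)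
    (hφ : ContinuousOn φ (Set.Icc a b)) {t : ℝ} (ht : t ∈ Set.Icc a b) :
    Continuous fun x => diffusionVec g f T (fun y => u y t) x :=
  continuousOn_univ.1 <| (hu.continuousOn_diffusionVec hab hφ).comp (f := fun x : M => (x, t))
    (by fun_prop) fun x _ => ⟨Set.mem_univ x, ht⟩

theorem IsHeatSolution.continuous_slice (hu : IsHeatSolution g f T φ a b u)
    {t : ℝ} (ht : t ∈ Set.Icc a b) : Continuous fun x => u x t :=
  (contMDiff_slice hu.smooth ht).continuous

/-- If every `u(·,t)` is an eigenfunction with the eigenvalue `c`, then `u` is obtained from its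
initial value by separation of variables. -/
theorem IsHeatSolution.eq_exp_smul (hu : IsHeatSolution g f T φ a b u) (hab : a < b)
    (hφ : ContinuousOn φ (Set.Icc a b)) {c : ℝ} {x : M}
    (hc : ∀ t ∈ Set.Icc a b, diffusionVec g f T (fun y => u y t) x = c • u x t)
    {t : ℝ} (ht : t ∈ Set.Icc a b) :
    u x t = Real.exp (t * c - a * c + ∫ τ in a..t, φ τ) • u x a := by
  -- `φ` is controlled only on `[a, b]`; a continuous extension to the line makes its primitive
  -- differentiable at the endpoints as well.
  set ψ : ℝ → ℝ := Set.IccExtend hab.le ((Set.Icc a b).domRestrict φ) with hψ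
  have hψc : Continuous ψ := (continuousOn_iff_continuous_domRestrict.1 hφ).Icc_extend'
  have hψφ : ∀ r ∈ Set.Icc a b, ψ r = φ r := fun r hr => Set.IccExtend_of_mem hab.le _ hr
  have hint : ∫ τ in a..t, φ τ = ∫ τ in a..t, ψ τ := by
    refine intervalIntegral.integral_congr fun r hr => (hψφ r ?_).symm
    rw [Set.uIcc_of_le ht.1] at hr
    exact ⟨hr.1, hr.2.trans ht.2⟩
  set θ : ℝ → ℝ := fun r => r * c - a * c + ∫ τ in a..r, ψ τ with hθ
  have hθ' : ∀ r, HasDerivAt θ (c + ψ r) r := by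
    intro r
    have h1 : HasDerivAt (fun r => r * c - a * c) c r := by
      simpa using ((hasDerivAt_id r).mul_const c).sub_const (a * c)
    exact h1.add (hψc.integral_hasStrictDerivAt a r).hasDerivAt
  -- Integrating factor: at the fixed point `x` the equation reads `u' = (c + φ)u`, and `θ' = c +
  -- ψ`.
  have hconst : ∀ r ∈ Set.Icc a b, HasDerivWithinAt (fun r => Real.exp (-θ r) • u x r) 0
      (Set.Icc a b) r := by
    intro r hr
    have h1 := ((hθ' r).neg.exp).hasDerivWithinAt (s := Set.Icc a b)
    have h2 := h1.smul (hu.hasDerivWithinAt x hr)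
    refine h2.congr_deriv ?_
    rw [hc r hr, hψφ r hr]
    module
  have h := (convex_Icc a b).is_const_of_fderivWithin_eq_zero (𝕜 := ℝ)
    (f := fun r => Real.exp (-θ r) • u x r)
    (fun r hr => (hconst r hr).differentiableWithinAt) (fun r hr => by
      have := (hconst r hr).hasFDerivWithinAt.fderivWithin (uniqueDiffOn_Icc hab r hr)
      rw [this]
      ext
      simp) ht (Set.left_mem_Icc.2 hab.le)
  have hθa : θ a = 0 := by simp [hθ]
  simp only [hθa, neg_zero, Real.exp_zero, one_smul] at h
  rw [hint, ← h, smul_smul, ← Real.exp_add]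
  simp [hθ]

end HeatSolution

/-! ### Evolution of the energies and the Cauchy–Schwarz inequality. -/

section Energies

variable {n m : ℕ} {M : Type*} [TopologicalSpace M]
  [ChartedSpace (EuclideanSpace ℝ (Fin n)) M] [IsManifold (𝓡 n) ∞ M]
  [T2Space M] [CompactSpace M] [MeasurableSpace M] [BorelSpace M]
  {g : Metric n M} {f : M → ℝ}
  {T : ∀ x : M, TangentSpace (𝓡 n) x →L[ℝ] TangentSpace (𝓡 n) x} {a b : ℝ} {φ : ℝ → ℝ}
  {u : M → ℝ → EuclideanSpace ℝ (Fin m)}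

/-- The energy `∫ |𝓛 u|² dμ`. -/
def energyL (g : Metric n M) (f : M → ℝ)
    (T : ∀ x : M, TangentSpace (𝓡 n) x →L[ℝ] TangentSpace (𝓡 n) x)
    (u : M → ℝ → EuclideanSpace ℝ (Fin m)) (t : ℝ) : ℝ :=
  ∫ x, ‖diffusionVec g f T (fun y => u y t) x‖ ^ 2 ∂(weightedVolume g f)

/-- The pairing lemma with `Φ = u`, because `|u(t)|² - |u(s)|² = ⟨u(t) - u(s), u(t) + u(s)⟩`. -/
theorem IsHeatSolution.hasDerivWithinAt_energyI (hu : IsHeatSolution g f T φ a b u) (hab : a < b)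
    (hf : ContMDiff (𝓡 n) 𝓘(ℝ, ℝ) 1 f) (hT : IsSymmPosDefTensor g T)
    (hφ : ContinuousOn φ (Set.Icc a b)) {t : ℝ} (ht : t ∈ Set.Icc a b) :
    HasDerivWithinAt (energyI g f u) (2 * energyD g f T u t + 2 * φ t * energyI g f u t)
      (Set.Icc a b) t := by
  have := isFiniteMeasure_weightedVolume g hf.continuous
  have hint : ∀ {F : Type _} [NormedAddCommGroup F] {h : M → F}, Continuous h →
      Integrable h (weightedVolume g f) := fun hh =>
    integrable_weightedVolume_of_continuous g hf.continuous hh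
  have hLc := hu.continuousOn_diffusionVec hab hφ
  have huc := hu.smooth.continuousOn
  have hφc : ContinuousOn (fun p : M × ℝ => φ p.2) (Set.univ ×ˢ Set.Icc a b) :=
    hφ.comp continuousOn_snd fun _ hp => hp.2
  have h := hasDerivWithinAt_of_sub_eq_integral_inner (weightedVolume g f)
    (u' := fun x t => diffusionVec g f T (fun y => u y t) x + φ t • u x t) (J := energyI g f u)
    huc (hLc.add (hφc.smul huc)) huc (fun x t ht => hu.hasDerivWithinAt x ht)
    (fun s hs t ht => by
      have hs' := hu.continuous_slice hs
      have ht' := hu.continuous_slice ht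
      rw [energyI, energyI, ← integral_sub (hint (by fun_prop)) (hint (by fun_prop))]
      congr 1
      funext x
      rw [inner_add_right, inner_sub_left, inner_sub_left, real_inner_self_eq_norm_sq,
        real_inner_self_eq_norm_sq, real_inner_comm (u x t) (u x s)]
      ring) ht
  refine h.congr_deriv ?_
  have hs' := hu.continuous_slice ht
  have hL' := hu.continuous_diffusionVec hab hφ ht
  rw [energyD_eq_integral_inner hf hT (contMDiff_slice hu.smooth ht), energyI, mul_assoc, ← mul_add,
    ← integral_const_mul (φ t), ← integral_add (hint (hs'.inner hL')) (hint (by fun_prop))]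
  congr 2
  funext x
  rw [inner_add_left, real_inner_smul_left, real_inner_self_eq_norm_sq, real_inner_comm]

theorem IsHeatSolution.hasDerivWithinAt_energyD (hu : IsHeatSolution g f T φ a b u) (hab : a < b)
    (hf : ContMDiff (𝓡 n) 𝓘(ℝ, ℝ) 1 f) (hT : IsSymmPosDefTensor g T)
    (hφ : ContinuousOn φ (Set.Icc a b)) {t : ℝ} (ht : t ∈ Set.Icc a b) :
    HasDerivWithinAt (energyD g f T u) (2 * energyL g f T u t + 2 * φ t * energyD g f T u t)
      (Set.Icc a b) t := by
  have := isFiniteMeasure_weightedVolume g hf.continuous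
  have hint : ∀ {F : Type _} [NormedAddCommGroup F] {h : M → F}, Continuous h →
      Integrable h (weightedVolume g f) := fun hh =>
    integrable_weightedVolume_of_continuous g hf.continuous hh
  have hLc := hu.continuousOn_diffusionVec hab hφ
  have huc := hu.smooth.continuousOn
  have hφc : ContinuousOn (fun p : M × ℝ => φ p.2) (Set.univ ×ˢ Set.Icc a b) :=
    hφ.comp continuousOn_snd fun _ hp => hp.2
  have h := hasDerivWithinAt_of_sub_eq_integral_inner (weightedVolume g f)
    (u' := fun x t => diffusionVec g f T (fun y => u y t) x + φ t • u x t)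
    (Φ := fun x t => diffusionVec g f T (fun y => u y t) x) (J := energyD g f T u)
    huc (hLc.add (hφc.smul huc)) hLc (fun x t ht => hu.hasDerivWithinAt x ht)
    (fun s hs t ht => by
      have hs' := hu.continuous_slice hs
      have ht' := hu.continuous_slice ht
      have hLs := hu.continuous_diffusionVec hab hφ hs
      have hLt := hu.continuous_diffusionVec hab hφ ht
      -- Here `Φ` is the operator applied to `u`; self-adjointness cancels the two mixed terms in
      -- `s` and `t`, leaving the increment of `D`.
      have hsym := integral_inner_diffusionVec_comm hf hT (contMDiff_slice hu.smooth ht)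
        (contMDiff_slice hu.smooth hs)
      simp only [inner_add_right, inner_sub_left]
      rw [integral_add (hint ((ht'.inner hLt).sub (hs'.inner hLt)))
          (hint ((ht'.inner hLs).sub (hs'.inner hLs))),
        integral_sub (hint (ht'.inner hLt)) (hint (hs'.inner hLt)),
        integral_sub (hint (ht'.inner hLs)) (hint (hs'.inner hLs)), hsym,
        energyD_eq_integral_inner hf hT (contMDiff_slice hu.smooth ht),
        energyD_eq_integral_inner hf hT (contMDiff_slice hu.smooth hs)]
      ring) ht
  refine h.congr_deriv ?_
  have hs' := hu.continuous_slice ht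
  have hL' := hu.continuous_diffusionVec hab hφ ht
  rw [energyD_eq_integral_inner hf hT (contMDiff_slice hu.smooth ht), energyL, mul_assoc, ← mul_add,
    ← integral_const_mul (φ t), ← integral_add (hint (by fun_prop)) (hint ((hs'.inner hL').const_mul _))]
  congr 2
  funext x
  rw [inner_add_left, real_inner_smul_left, real_inner_self_eq_norm_sq]

/-- Serves twice: nonnegativity for all `c` yields Cauchy–Schwarz, and `c` equal to the frequency
detects the equality case. -/
theorem IsHeatSolution.integral_norm_sub_sq (hu : IsHeatSolution g f T φ a b u) (hab : a < b)
    (hf : ContMDiff (𝓡 n) 𝓘(ℝ, ℝ) 1 f) (hT : IsSymmPosDefTensor g T)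
    (hφ : ContinuousOn φ (Set.Icc a b)) {t : ℝ} (ht : t ∈ Set.Icc a b) (c : ℝ) :
    ∫ x, ‖diffusionVec g f T (fun y => u y t) x - c • u x t‖ ^ 2 ∂(weightedVolume g f) =
      energyL g f T u t - 2 * c * energyD g f T u t + c ^ 2 * energyI g f u t := by
  have hint : ∀ {F : Type _} [NormedAddCommGroup F] {h : M → F}, Continuous h →
      Integrable h (weightedVolume g f) := fun hh =>
    integrable_weightedVolume_of_continuous g hf.continuous hh
  have hs' := hu.continuous_slice ht
  have hL' := hu.continuous_diffusionVec hab hφ ht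
  have hin := (hs'.inner hL').const_mul (2 * c)
  have hdiff : Continuous fun x => ‖diffusionVec g f T (fun y => u y t) x‖ ^ 2 -
      2 * c * inner ℝ (u x t) (diffusionVec g f T (fun y => u y t) x) := by fun_prop
  rw [energyD_eq_integral_inner hf hT (contMDiff_slice hu.smooth ht), energyL, energyI,
    ← integral_const_mul, ← integral_const_mul,
    ← integral_sub (hint (by fun_prop)) (hint hin),
    ← integral_add (hint hdiff) (hint (by fun_prop))]
  congr 1
  funext x
  rw [norm_sub_sq_real, real_inner_smul_right, real_inner_comm, norm_smul, mul_pow, Real.norm_eq_abs,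
    sq_abs]
  ring

theorem energyI_nonneg (g : Metric n M) (f : M → ℝ) (u : M → ℝ → EuclideanSpace ℝ (Fin m))
    (t : ℝ) : 0 ≤ energyI g f u t :=
  integral_nonneg fun _ => sq_nonneg _

/-- A quadratic polynomial in `c` that is nowhere negative has nonpositive discriminant. -/
theorem IsHeatSolution.energyD_sq_le (hu : IsHeatSolution g f T φ a b u) (hab : a < b)
    (hf : ContMDiff (𝓡 n) 𝓘(ℝ, ℝ) 1 f) (hT : IsSymmPosDefTensor g T)
    (hφ : ContinuousOn φ (Set.Icc a b)) {t : ℝ} (ht : t ∈ Set.Icc a b) :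
    energyD g f T u t ^ 2 ≤ energyI g f u t * energyL g f T u t := by
  have h : ∀ c : ℝ, 0 ≤ energyI g f u t * (c * c) + (-2 * energyD g f T u t) * c
      + energyL g f T u t := by
    intro c
    have h0 : 0 ≤ ∫ x, ‖diffusionVec g f T (fun y => u y t) x - c • u x t‖ ^ 2
        ∂(weightedVolume g f) := integral_nonneg fun _ => sq_nonneg _
    rw [hu.integral_norm_sub_sq hab hf hT hφ ht c] at h0
    linarith
  have := discrim_le_zero h
  rw [discrim] at this
  linarith

theorem eq_zero_of_integral_norm_sq_eq_zero (g : Metric n M) (hf : Continuous f)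
    {h : M → EuclideanSpace ℝ (Fin m)} (hh : Continuous h)
    (h0 : ∫ x, ‖h x‖ ^ 2 ∂(weightedVolume g f) = 0) (x : M) : h x = 0 := by
  have := isOpenPosMeasure_weightedVolume g hf
  have hc : Continuous fun x => ‖h x‖ ^ 2 := by fun_prop
  have h1 := (integral_eq_zero_iff_of_nonneg (fun x => sq_nonneg ‖h x‖)
    (integrable_weightedVolume_of_continuous g hf hc)).1 h0
  have h2 : (fun x => ‖h x‖ ^ 2) = fun _ => (0 : ℝ) :=
    (Continuous.ae_eq_iff_eq (weightedVolume g f) hc continuous_const).1 h1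
  simpa using congrFun h2 x

end Energies

end WeightedManifold

end

/-! ### Assembly of the main theorem. -/

theorem theorem1 {n m : ℕ} {M : Type*} [TopologicalSpace M]
    [ChartedSpace (EuclideanSpace ℝ (Fin n)) M] [IsManifold (𝓡 n) ∞ M]
    [T2Space M] [CompactSpace M] [MeasurableSpace M] [BorelSpace M]
    (g : WeightedManifold.Metric n M)
    (f : M → ℝ) (hf : ContMDiff (𝓡 n) 𝓘(ℝ, ℝ) 2 f)
    (T : ∀ x : M, TangentSpace (𝓡 n) x →L[ℝ] TangentSpace (𝓡 n) x)
    (hT : WeightedManifold.IsSymmPosDefTensor g T)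
    (a b : ℝ) (hab : a < b)
    (φ : ℝ → ℝ) (hφ : ContDiffOn ℝ ∞ φ (Set.Icc a b))
    (u : M → ℝ → EuclideanSpace ℝ (Fin m))
    (hu : WeightedManifold.IsHeatSolution g f T φ a b u)
    (hne : ∃ x, ∃ t ∈ Set.Icc a b, u x t ≠ 0) :
    (∀ t ∈ Set.Icc a b, 0 < WeightedManifold.energyI g f u t) ∧
    MonotoneOn (WeightedManifold.frequency g f T u) (Set.Icc a b) ∧
    ((∀ s ∈ Set.Icc a b, ∀ t ∈ Set.Icc a b,
        WeightedManifold.frequency g f T u s = WeightedManifold.frequency g f T u t) →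
      ∀ t ∈ Set.Icc a b,
        WeightedManifold.IsEigenfunction g f T (WeightedManifold.frequency g f T u t)
          (fun x => u x t) ∧
        ∀ x, u x t =
          Real.exp (t * WeightedManifold.frequency g f T u t
            - a * WeightedManifold.frequency g f T u a + ∫ τ in a..t, φ τ) • u x a) ∧
    (MonotoneOn φ (Set.Icc a b) →
      ConvexOn ℝ (Set.Icc a b) (fun t => Real.log (WeightedManifold.energyI g f u t))) := by
  have hf1 : ContMDiff (𝓡 n) 𝓘(ℝ, ℝ) 1 f := hf.of_le (by norm_num)
  have hφc := hφ.continuousOn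
  obtain ⟨x₀, t₀, ht₀, hx₀⟩ := hne
  have hI := fun t (ht : t ∈ Set.Icc a b) => hu.hasDerivWithinAt_energyI hab hf1 hT hφc ht
  have hD := fun t (ht : t ∈ Set.Icc a b) => hu.hasDerivWithinAt_energyD hab hf1 hT hφc ht
  have hCS := fun t (ht : t ∈ Set.Icc a b) => hu.energyD_sq_le hab hf1 hT hφc ht
  have hI₀ : 0 < WeightedManifold.energyI g f u t₀ := by
    refine lt_of_le_of_ne (WeightedManifold.energyI_nonneg g f u t₀) fun h => hx₀ ?_
    exact WeightedManifold.eq_zero_of_integral_norm_sq_eq_zero g hf.continuous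
      (hu.continuous_slice ht₀) h.symm x₀
  have hpos : ∀ t ∈ Set.Icc a b, 0 < WeightedManifold.energyI g f u t := fun t ht =>
    WeightedManifold.energy_pos hI hD hφc
      (fun t _ => WeightedManifold.energyI_nonneg g f u t)
      (fun t _ => WeightedManifold.energyD_nonpos hT u t) hCS ht₀ hI₀ ht
  have hU : MonotoneOn (WeightedManifold.frequency g f T u) (Set.Icc a b) :=
    WeightedManifold.frequency_monotoneOn_of_pos hI hD hCS subset_rfl hpos
  refine ⟨hpos, hU, fun hconst => ?_, fun hφm =>
    WeightedManifold.log_energy_convexOn hI hpos hU hφm⟩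
  have heig : ∀ t ∈ Set.Icc a b, ∀ x,
      WeightedManifold.diffusionVec g f T (fun y => u y t) x =
        WeightedManifold.frequency g f T u t • u x t := by
    intro t ht x
    have hp := (hpos t ht).ne'
    have heq := WeightedManifold.cauchySchwarz_eq_of_frequency_const hab hI hD hpos hconst ht
    have hsmul : Continuous fun x => WeightedManifold.frequency g f T u t • u x t :=
      (hu.continuous_slice ht).const_smul (WeightedManifold.frequency g f T u t)
    refine sub_eq_zero.1 (WeightedManifold.eq_zero_of_integral_norm_sq_eq_zero g hf.continuous
      (h := fun x => WeightedManifold.diffusionVec g f T (fun y => u y t) x -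
        WeightedManifold.frequency g f T u t • u x t)
      ((hu.continuous_diffusionVec hab hφc ht).sub hsmul) ?_ x)
    -- With `c = D / I` the integral equals `E - D² / I`, which vanishes by the equality case `heq`.
    rw [hu.integral_norm_sub_sq hab hf1 hT hφc ht, WeightedManifold.frequency]
    field_simp
    linarith
  intro t ht
  have ha : a ∈ Set.Icc a b := Set.left_mem_Icc.2 hab.le
  refine ⟨⟨fun h0 => ?_, heig t ht⟩, fun x => ?_⟩
  · refine (hpos t ht).ne' ?_
    have h0' : ∀ x, u x t = 0 := fun x => congrFun h0 x
    simp [WeightedManifold.energyI, h0']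
  -- Replacing `U(t)` by `U(a)` makes the eigenvalue independent of time, as separation of variables
  -- requires.
  · rw [hconst t ht a ha]
    refine hu.eq_exp_smul hab hφc (fun s hs => ?_) ht
    rw [heig s hs x, hconst s hs a ha]
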